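/- Let $k$ be a field of characteristic zero. Let $X$ and $Y$ be $\mathbb{S}$-modules over $k$ with $X(n)=Y(n)=0$ for $n\le 1$, let $R\subseteq T(X)$ and $S\subseteq T(Y)$ be sets of elements of the free symmetric operads, and let $P=T(X)/(R)$ and $Q=T(Y)/(S)$ be the corresponding quotients by operadic ideals. Let $P\vee Q = T(X\oplus Y)/(R\cup S)$ be their coproduct. Let $Y\circ X$ be the composite $\mathbb{S}$-module, viewed as the subspace of $T(X\oplus Y)$ spanned by the elements $\alpha(\beta_1,\ldots,\beta_m)$ with $\alpha\in Y(m)$ and $\beta_1,\ldots,\beta_m\in X$ (with arbitrary bijective labellings of the inputs). The almost composite product of $P$ and $Q$ is the operad $$P\triangledown_0 Q := P\vee Q\,/\,\bigl(\alpha(\beta_1,\ldots,\beta_m) : \alpha\in Y,\ \beta_i\in X\bigr).$$ Let $f\colon Y\circ X\to P\vee Q$ be an arity-preserving linear map whose image is contained in the right ideal of $P\vee Q$ generated by the image of $X$, and let $$O := P\vee Q\,/\,\bigl(\alpha(\beta_1,\ldots,\beta_m)-f(\alpha(\beta_1,\ldots,\beta_m)) : \alpha\in Y,\ \beta_i\in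 X\bigr).$$ Then for each $n\ge 1$ there is a surjection of vector spaces $$(P\triangledown_0 Q)(n)\twoheadrightarrow O(n).$$ -/

import Mathlib

universe u v w

noncomputable section

/-! Symmetric operads over a field, free operads, ideals and quotients. -/

/-- An `S`-module: a sequence of linear representations of the symmetric groups
(the left action of `σ` is the right action of `σ⁻¹`). -/
structure SModule (k : Type u) [Field k] where
  obj : ℕ → Type v
  [addCommGroup : ∀ n, AddCommGroup (obj n)]
  [module : ∀ n, Module k (obj n)]
  ρ : ∀ n, Representation k (Equiv.Perm (Fin n)) (obj n)

attribute [instance] SModule.addCommGroup SModule.module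

/-- The direct sum of two `S`-modules. -/
def SModule.sum {k : Type u} [Field k] (X : SModule.{u, v} k) (Y : SModule.{u, w} k) :
    SModule.{u, max v w} k where
  obj n := X.obj n × Y.obj n
  ρ n := (X.ρ n).prod (Y.ρ n)

/-! Bijections of finite sets used to state the axioms of an operad. -/

/-- `I ⊔ (J ⊔ {∗}) ≃ (I ⊔ J) ⊔ {∗}`. -/
def sumOptionEquiv (I J : Type) : I ⊕ Option J ≃ Option (I ⊕ J) where
  toFun
    | .inl i => some (.inl i)
    | .inr none => none
    | .inr (some j) => some (.inr j)
  invFun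
    | none => .inr none
    | some (.inl i) => .inl i
    | some (.inr j) => .inr (some j)
  left_inv := by rintro (i | _ | j) <;> rfl
  right_inv := by rintro (_ | i | j) <;> rfl

/-- `(I ⊔ {∗}) ⊔ J ≃ (I ⊔ J) ⊔ {∗}`. -/
def optionSumEquiv (I J : Type) : Option I ⊕ J ≃ Option (I ⊕ J) where
  toFun
    | .inl none => none
    | .inl (some i) => some (.inl i)
    | .inr j => some (.inr j)
  invFun
    | none => .inl none
    | some (.inl i) => .inl (some i)
    | some (.inr j) => .inr j
  left_inv := by rintro ((_ | i) | j) <;> rfl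
  right_inv := by rintro (_ | i | j) <;> rfl

/-- The exchange of the two added points. -/
def optionSwapEquiv (I : Type) : Option (Option I) ≃ Option (Option I) where
  toFun
    | none => some none
    | some none => none
    | some (some i) => some (some i)
  invFun
    | none => some none
    | some none => none
    | some (some i) => some (some i)
  left_inv := by rintro (_ | _ | i) <;> rfl
  right_inv := by rintro (_ | _ | i) <;> rfl

/-- `(I ⊔ J) ⊔ K ≃ (I ⊔ K) ⊔ J`. -/
def sumRightCommEquiv (I J K : Type) : (I ⊕ J) ⊕ K ≃ (I ⊕ K) ⊕ J where
  toFun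
    | .inl (.inl i) => .inl (.inl i)
    | .inl (.inr j) => .inr j
    | .inr x => .inl (.inr x)
  invFun
    | .inl (.inl i) => .inl (.inl i)
    | .inl (.inr x) => .inr x
    | .inr j => .inl (.inr j)
  left_inv := by rintro ((i | j) | x) <;> rfl
  right_inv := by rintro ((i | x) | j) <;> rfl

/-- `{∗} ≃ ∅ ⊔ {∗}`. -/
def unitOptionEquiv : Unit ≃ Option Empty where
  toFun _ := none
  invFun _ := ()
  left_inv _ := rfl
  right_inv := by rintro (_ | i); exacts [rfl, i.elim]

/-- A symmetric operad over `k`, in coordinate-free form (components indexed by finite sets,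
arity `n` being the component of `Fin n`) and with partial compositions:
`comp p q` is the substitution of `q` into the input `none` of `p`; substitution into another
input is obtained by relabelling. -/
structure Operad (k : Type u) [Field k] where
  obj : (I : Type) → [Finite I] → Type v
  [addCommGroup : ∀ (I : Type) [Finite I], AddCommGroup (obj I)]
  [module : ∀ (I : Type) [Finite I], Module k (obj I)]
  map : ∀ {I J : Type} [Finite I] [Finite J], I ≃ J → (obj I →ₗ[k] obj J)
  one : obj Unit
  comp : ∀ {I J : Type} [Finite I] [Finite J],
    obj (Option I) →ₗ[k] obj J →ₗ[k] obj (I ⊕ J)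
  map_refl : ∀ {I : Type} [Finite I] (p : obj I), map (Equiv.refl I) p = p
  map_trans : ∀ {I J K : Type} [Finite I] [Finite J] [Finite K] (e : I ≃ J) (e' : J ≃ K)
    (p : obj I), map (e.trans e') p = map e' (map e p)
  comp_map : ∀ {I J I' J' : Type} [Finite I] [Finite J] [Finite I'] [Finite J']
    (e : I ≃ I') (e' : J ≃ J') (p : obj (Option I)) (q : obj J),
    comp (map e.optionCongr p) (map e' q) = map (e.sumCongr e') (comp p q)
  one_comp : ∀ {J : Type} [Finite J] (q : obj J),
    comp (map unitOptionEquiv one) q = map (Equiv.emptySum Empty J).symm q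
  comp_one : ∀ {I : Type} [Finite I] (p : obj (Option I)),
    comp p one = map (Equiv.optionEquivSumPUnit I) p
  comp_seq : ∀ {I J K : Type} [Finite I] [Finite J] [Finite K]
    (p : obj (Option I)) (q : obj (Option J)) (r : obj K),
    comp (map (sumOptionEquiv I J) (comp p q)) r
      = map (Equiv.sumAssoc I J K).symm (comp p (comp q r))
  comp_par : ∀ {I J K : Type} [Finite I] [Finite J] [Finite K]
    (p : obj (Option (Option I))) (q : obj J) (r : obj K),
    map (sumRightCommEquiv I J K) (comp (map (optionSumEquiv I J) (comp p q)) r)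
      = comp (map (optionSumEquiv I K) (comp (map (optionSwapEquiv I) p) r)) q

attribute [instance] Operad.addCommGroup Operad.module

namespace Operad

variable {k : Type u} [Field k]

/-! Ideals and quotients. -/

/-- Membership in the (two-sided, operadic) ideal generated by `G`. -/
inductive InIdeal (P : Operad.{u, v} k) (G : ∀ n : ℕ, Set (P.obj (Fin n))) :
    ∀ {I : Type} [Finite I], P.obj I → Prop
  | of {n : ℕ} {p : P.obj (Fin n)} (h : p ∈ G n) : InIdeal P G p
  | zero {I : Type} [Finite I] : InIdeal P G (0 : P.obj I)
  | add {I : Type} [Finite I] {p q : P.obj I} (hp : InIdeal P G p) (hq : InIdeal P G q) :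
      InIdeal P G (p + q)
  | smul {I : Type} [Finite I] (a : k) {p : P.obj I} (hp : InIdeal P G p) : InIdeal P G (a • p)
  | map {I J : Type} [Finite I] [Finite J] (e : I ≃ J) {p : P.obj I} (hp : InIdeal P G p) :
      InIdeal P G (P.map e p)
  | comp_left {I J : Type} [Finite I] [Finite J] {p : P.obj (Option I)} (hp : InIdeal P G p)
      (q : P.obj J) : InIdeal P G (P.comp p q)
  | comp_right {I J : Type} [Finite I] [Finite J] (p : P.obj (Option I)) {q : P.obj J}
      (hq : InIdeal P G q) : InIdeal P G (P.comp p q)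

/-- The component at `I` of the operadic ideal generated by `G`. -/
def ideal (P : Operad.{u, v} k) (G : ∀ n : ℕ, Set (P.obj (Fin n))) (I : Type) [Finite I] :
    Submodule k (P.obj I) where
  carrier := {p | InIdeal P G p}
  zero_mem' := InIdeal.zero
  add_mem' := InIdeal.add
  smul_mem' a _ h := InIdeal.smul a h

/-- Membership in the right ideal generated by `G`: only composites `p ∘ᵢ q` with `p` in the
ideal are required to belong to it. -/
inductive InRightIdeal (P : Operad.{u, v} k) (G : ∀ n : ℕ, Set (P.obj (Fin n))) :
    ∀ {I : Type} [Finite I], P.obj I → Prop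
  | of {n : ℕ} {p : P.obj (Fin n)} (h : p ∈ G n) : InRightIdeal P G p
  | zero {I : Type} [Finite I] : InRightIdeal P G (0 : P.obj I)
  | add {I : Type} [Finite I] {p q : P.obj I} (hp : InRightIdeal P G p)
      (hq : InRightIdeal P G q) : InRightIdeal P G (p + q)
  | smul {I : Type} [Finite I] (a : k) {p : P.obj I} (hp : InRightIdeal P G p) :
      InRightIdeal P G (a • p)
  | map {I J : Type} [Finite I] [Finite J] (e : I ≃ J) {p : P.obj I}
      (hp : InRightIdeal P G p) : InRightIdeal P G (P.map e p)
  | comp_left {I J : Type} [Finite I] [Finite J] {p : P.obj (Option I)}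
      (hp : InRightIdeal P G p) (q : P.obj J) : InRightIdeal P G (P.comp p q)

/-- The component at `I` of the right ideal generated by `G`. -/
def rightIdeal (P : Operad.{u, v} k) (G : ∀ n : ℕ, Set (P.obj (Fin n))) (I : Type) [Finite I] :
    Submodule k (P.obj I) where
  carrier := {p | InRightIdeal P G p}
  zero_mem' := InRightIdeal.zero
  add_mem' := InRightIdeal.add
  smul_mem' a _ h := InRightIdeal.smul a h

/-- The partial composition of the quotient `P / (G)`. -/
def quotientComp (P : Operad.{u, v} k) (G : ∀ n : ℕ, Set (P.obj (Fin n))) (I J : Type)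
    [Finite I] [Finite J] :
    (P.obj (Option I) ⧸ P.ideal G (Option I)) →ₗ[k] (P.obj J ⧸ P.ideal G J) →ₗ[k]
      (P.obj (I ⊕ J) ⧸ P.ideal G (I ⊕ J)) :=
  (P.ideal G (Option I)).liftQ
    { toFun := fun p => (P.ideal G J).mapQ (P.ideal G (I ⊕ J)) (P.comp p)
        fun _ h => InIdeal.comp_right p h
      map_add' := fun p q => by
        refine Submodule.linearMap_qext _ (LinearMap.ext fun r => ?_)
        exact congrArg Submodule.Quotient.mk (by simp : P.comp (p + q) r = _)
      map_smul' := fun a p => by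
        refine Submodule.linearMap_qext _ (LinearMap.ext fun r => ?_)
        exact congrArg Submodule.Quotient.mk (by simp : P.comp (a • p) r = _) }
    (fun p h => by
      refine LinearMap.mem_ker.2 (Submodule.linearMap_qext _ (LinearMap.ext fun q => ?_))
      exact (Submodule.Quotient.mk_eq_zero (P.ideal G (I ⊕ J))).2 (InIdeal.comp_left h q))

/-- The quotient operad `P / (G)`. -/
def quotient (P : Operad.{u, v} k) (G : ∀ n : ℕ, Set (P.obj (Fin n))) : Operad.{u, v} k where
  obj I _ := P.obj I ⧸ P.ideal G I
  map {I J} _ _ e := (P.ideal G I).mapQ (P.ideal G J) (P.map e) fun _ h => InIdeal.map e h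
  one := (P.ideal G Unit).mkQ P.one
  comp {I J} _ _ := P.quotientComp G I J
  map_refl p := by
    obtain ⟨p, rfl⟩ := Submodule.Quotient.mk_surjective _ p
    exact congrArg Submodule.Quotient.mk (P.map_refl p)
  map_trans e e' p := by
    obtain ⟨p, rfl⟩ := Submodule.Quotient.mk_surjective _ p
    exact congrArg Submodule.Quotient.mk (P.map_trans e e' p)
  comp_map e e' p q := by
    obtain ⟨p, rfl⟩ := Submodule.Quotient.mk_surjective _ p
    obtain ⟨q, rfl⟩ := Submodule.Quotient.mk_surjective _ q
    exact congrArg Submodule.Quotient.mk (P.comp_map e e' p q)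
  one_comp q := by
    obtain ⟨q, rfl⟩ := Submodule.Quotient.mk_surjective _ q
    exact congrArg Submodule.Quotient.mk (P.one_comp q)
  comp_one p := by
    obtain ⟨p, rfl⟩ := Submodule.Quotient.mk_surjective _ p
    exact congrArg Submodule.Quotient.mk (P.comp_one p)
  comp_seq p q r := by
    obtain ⟨p, rfl⟩ := Submodule.Quotient.mk_surjective _ p
    obtain ⟨q, rfl⟩ := Submodule.Quotient.mk_surjective _ q
    obtain ⟨r, rfl⟩ := Submodule.Quotient.mk_surjective _ r
    exact congrArg Submodule.Quotient.mk (P.comp_seq p q r)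
  comp_par p q r := by
    obtain ⟨p, rfl⟩ := Submodule.Quotient.mk_surjective _ p
    obtain ⟨q, rfl⟩ := Submodule.Quotient.mk_surjective _ q
    obtain ⟨r, rfl⟩ := Submodule.Quotient.mk_surjective _ r
    exact congrArg Submodule.Quotient.mk (P.comp_par p q r)

/-- The projection `P → P / (G)`. -/
def quotientMk (P : Operad.{u, v} k) (G : ∀ n : ℕ, Set (P.obj (Fin n))) {I : Type} [Finite I] :
    P.obj I →ₗ[k] (P.quotient G).obj I :=
  (P.ideal G I).mkQ

end Operad

/-! Trees and the free operad. -/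

/-- Planar rooted trees whose leaves are labelled by `I` and whose vertices with `n` inputs are
labelled by `G n`. -/
inductive DecTree (G : ℕ → Type v) (I : Type) : Type v
  | leaf (i : I) : DecTree G I
  | node {n : ℕ} (x : G n) (c : Fin n → DecTree G I) : DecTree G I

namespace DecTree

variable {G : ℕ → Type v} {I J K : Type}

/-- The leaf labels, from left to right. -/
def leaves : DecTree G I → List I
  | leaf i => [i]
  | node _ c => (List.ofFn fun j => (c j).leaves).flatten

/-- Each element of `I` labels exactly one leaf. -/
def IsLinear (t : DecTree G I) : Prop := t.leaves.Nodup ∧ ∀ i, i ∈ t.leaves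

/-- Substitution of trees for the leaves. -/
def bind (f : I → DecTree G J) : DecTree G I → DecTree G J
  | leaf i => f i
  | node x c => node x fun j => (c j).bind f

/-- Relabelling of the leaves. -/
def relabel (f : I → J) (t : DecTree G I) : DecTree G J := t.bind fun i => leaf (f i)

/-- Grafting of `s` at the leaf `none` of `t`. -/
def graft (t : DecTree G (Option I)) (s : DecTree G J) : DecTree G (I ⊕ J) :=
  t.bind fun o => o.elim (s.relabel Sum.inr) fun i => leaf (Sum.inl i)

/-- Change of the vertex labels. -/
def mapLabel {H : ℕ → Type w} (φ : ∀ n, G n → H n) : DecTree G I → DecTree H I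
  | leaf i => leaf i
  | node x c => node (φ _ x) fun j => (c j).mapLabel φ

theorem leaves_bind (f : I → DecTree G J) (t : DecTree G I) :
    (t.bind f).leaves = t.leaves.flatMap fun i => (f i).leaves := by
  induction t with
  | leaf i => simp [bind, leaves]
  | node x c ih =>
    simp only [bind, leaves, ih, List.flatMap_def, List.map_flatten, List.map_ofFn,
      List.flatten_flatten]
    rfl

theorem leaves_relabel (f : I → J) (t : DecTree G I) :
    (t.relabel f).leaves = t.leaves.map f := by
  simp [relabel, leaves_bind, leaves, ← List.map_eq_flatMap]

theorem leaves_mapLabel {H : ℕ → Type w} (φ : ∀ n, G n → H n) (t : DecTree G I) :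
    (t.mapLabel φ).leaves = t.leaves := by
  induction t with
  | leaf i => simp [mapLabel, leaves]
  | node x c ih => simp [mapLabel, leaves, ih]

theorem mem_leaves_leaf (i j : I) : i ∈ (leaf j : DecTree G I).leaves ↔ i = j :=
  List.mem_singleton

theorem mem_leaves_node {n : ℕ} (x : G n) (c : Fin n → DecTree G I) (i : I) :
    i ∈ (node x c).leaves ↔ ∃ j, i ∈ (c j).leaves := by
  simp [leaves, List.mem_flatten, List.mem_ofFn]

theorem nodup_leaves_node {n : ℕ} (x : G n) (c : Fin n → DecTree G I)
    (h : ∀ j, (c j).leaves.Nodup)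
    (h' : ∀ j l, ∀ i ∈ (c j).leaves, i ∈ (c l).leaves → j = l) : (node x c).leaves.Nodup := by
  simp only [leaves, List.nodup_flatten, List.pairwise_ofFn, List.mem_ofFn]
  refine ⟨?_, fun j l hjl i hi hi' => hjl.ne (h' j l i hi hi')⟩
  rintro _ ⟨j, rfl⟩
  exact h j

theorem bind_bind (f : I → DecTree G J) (g : J → DecTree G K) (t : DecTree G I) :
    (t.bind f).bind g = t.bind fun i => (f i).bind g := by
  induction t with
  | leaf i => rfl
  | node x c ih => simp [bind, ih]

theorem bind_leaf (t : DecTree G I) : t.bind leaf = t := by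
  induction t with
  | leaf i => rfl
  | node x c ih => simp [bind, ih]

theorem IsLinear.relabel {t : DecTree G I} (h : t.IsLinear) (e : I ≃ J) :
    (t.relabel e).IsLinear := by
  refine ⟨?_, fun j => ?_⟩
  · rw [leaves_relabel]; exact h.1.map e.injective
  · rw [leaves_relabel]; exact List.mem_map.2 ⟨e.symm j, h.2 _, by simp⟩

theorem IsLinear.graft {t : DecTree G (Option I)} {s : DecTree G J} (ht : t.IsLinear)
    (hs : s.IsLinear) : (t.graft s).IsLinear := by
  refine ⟨?_, fun j => ?_⟩
  · rw [DecTree.graft, leaves_bind, List.nodup_flatMap]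
    constructor
    · rintro (_ | i) -
      · simpa [leaves_relabel] using hs.1.map Sum.inr_injective
      · simp [leaves]
    · refine List.Pairwise.imp ?_ ht.1
      rintro (_ | i) (_ | j) hij <;>
        simp_all [leaves_relabel, leaves, Function.onFun, eq_comm]
  · rw [DecTree.graft, leaves_bind, List.mem_flatMap]
    rcases j with i | j
    · exact ⟨some i, ht.2 _, by simp [leaves]⟩
    · exact ⟨none, ht.2 _, by simpa [leaves_relabel] using hs.2 j⟩

theorem IsLinear.mapLabel {H : ℕ → Type w} (φ : ∀ n, G n → H n) {t : DecTree G I}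
    (h : t.IsLinear) : (t.mapLabel φ).IsLinear := by
  simpa [IsLinear, leaves_mapLabel] using h

end DecTree

namespace FreeOperad

open DecTree

variable {k : Type u} [Field k]

/-- The relations between decorated trees: they are linear in the label of each vertex, and
a permutation acting on the label of a vertex permutes the subtrees. -/
inductive Rel (X : SModule.{u, v} k) {I : Type} : (DecTree X.obj I →₀ k) → Prop
  | add {n : ℕ} (x y : X.obj n) (c : Fin n → DecTree X.obj I) :
      Rel X (.single (node (x + y) c) 1 - .single (node x c) 1 - .single (node y c) 1)
  | smul {n : ℕ} (a : k) (x : X.obj n) (c : Fin n → DecTree X.obj I) :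
      Rel X (.single (node (a • x) c) 1 - .single (node x c) a)
  | perm {n : ℕ} (σ : Equiv.Perm (Fin n)) (x : X.obj n) (c : Fin n → DecTree X.obj I) :
      Rel X (.single (node (X.ρ n σ x) c) 1 - .single (node x (c ∘ σ)) 1)
  | congr {n : ℕ} (x : X.obj n) (c : Fin n → DecTree X.obj I) (j : Fin n)
      {r : DecTree X.obj I →₀ k} (h : Rel X r) :
      Rel X (r.mapDomain fun t => node x (Function.update c j t))

/-- Linear combinations of trees that vanish in the free operad. -/
def relSpan (X : SModule.{u, v} k) (I : Type) : Submodule k (DecTree X.obj I →₀ k) :=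
  Submodule.span k {r | Rel X r}

/-- Trees with each element of `I` labelling exactly one leaf. -/
abbrev LinTree (X : SModule.{u, v} k) (I : Type) : Type v :=
  {t : DecTree X.obj I // t.IsLinear}

/-- The relations between trees in which each label occurs once. -/
def linRel (X : SModule.{u, v} k) (I : Type) : Submodule k (LinTree X I →₀ k) :=
  (relSpan X I).comap (Finsupp.lmapDomain k k Subtype.val)

/-- The component at `I` of the free operad on `X`. -/
abbrev Obj (X : SModule.{u, v} k) (I : Type) : Type (max u v) :=
  (LinTree X I →₀ k) ⧸ linRel X I

theorem node_mem_relSpan (X : SModule.{u, v} k) {I : Type} {n : ℕ} (x : X.obj n)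
    (c : Fin n → DecTree X.obj I) (j : Fin n) {r : DecTree X.obj I →₀ k}
    (hr : r ∈ relSpan X I) :
    r.mapDomain (fun t => node x (Function.update c j t)) ∈ relSpan X I := by
  have : relSpan X I ≤ (relSpan X I).comap
      (Finsupp.lmapDomain k k fun t => node x (Function.update c j t)) :=
    Submodule.span_le.2 fun r hr => Submodule.subset_span (Rel.congr x c j hr)
  exact this hr

theorem bind_mem_relSpan (X : SModule.{u, v} k) {I J : Type} (f : I → DecTree X.obj J)
    {r : DecTree X.obj I →₀ k} (hr : r ∈ relSpan X I) :
    r.mapDomain (DecTree.bind f) ∈ relSpan X J := by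
  have : relSpan X I ≤ (relSpan X J).comap (Finsupp.lmapDomain k k (DecTree.bind f)) := by
    refine Submodule.span_le.2 fun r (hr : Rel X r) => ?_
    change Finsupp.lmapDomain k k (DecTree.bind f) r ∈ relSpan X J
    induction hr with
    | add x y c =>
      simp only [map_sub, Finsupp.lmapDomain_apply, Finsupp.mapDomain_single, DecTree.bind]
      exact Submodule.subset_span (Rel.add x y _)
    | smul a x c =>
      simp only [map_sub, Finsupp.lmapDomain_apply, Finsupp.mapDomain_single, DecTree.bind]
      exact Submodule.subset_span (Rel.smul a x _)
    | perm σ x c =>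
      simp only [map_sub, Finsupp.lmapDomain_apply, Finsupp.mapDomain_single, DecTree.bind]
      exact Submodule.subset_span (Rel.perm σ x fun j => (c j).bind f)
    | congr x c j _ ih =>
      have := node_mem_relSpan X x (fun i => (c i).bind f) j ih
      simp only [Finsupp.lmapDomain_apply, ← Finsupp.mapDomain_comp] at this ⊢
      convert this using 2
      funext t
      simp only [Function.comp_apply, DecTree.bind]
      congr 1
      funext i
      by_cases h : i = j
      · subst h; simp
      · simp [h]
  exact this hr

theorem bind_congr {G : ℕ → Type v} {I J : Type} {f g : I → DecTree G J} (t : DecTree G I)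
    (h : ∀ i ∈ t.leaves, f i = g i) : t.bind f = t.bind g := by
  induction t with
  | leaf i => exact h i (by simp [leaves])
  | node x c ih =>
    simp only [DecTree.bind]
    congr 1
    funext j
    refine ih j fun i hi => h i ?_
    simp only [leaves, List.mem_flatten]
    exact ⟨_, List.mem_ofFn.2 ⟨j, rfl⟩, hi⟩

theorem graft_mem_relSpan (X : SModule.{u, v} k) {I J : Type} (t : DecTree X.obj (Option I))
    (ht : t.leaves.Nodup) (hn : none ∈ t.leaves) {r : DecTree X.obj J →₀ k}
    (hr : r ∈ relSpan X J) : r.mapDomain (fun s => t.graft s) ∈ relSpan X (I ⊕ J) := by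
  rcases isEmpty_or_nonempty (DecTree X.obj J) with he | ⟨⟨s₀⟩⟩
  · rw [Subsingleton.elim r 0, Finsupp.mapDomain_zero]
    exact Submodule.zero_mem _
  induction t with
  | leaf o =>
    obtain rfl : none = o := by simpa [leaves] using hn
    exact bind_mem_relSpan X _ hr
  | node x c ih =>
    simp only [leaves, List.nodup_flatten, List.mem_flatten, List.mem_ofFn] at ht hn
    obtain ⟨_, ⟨j, rfl⟩, hj⟩ := hn
    have hd : ∀ i, i ≠ j → none ∉ (c i).leaves := by
      intro i hi hmem
      have := List.pairwise_ofFn.1 ht.2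
      rcases lt_or_gt_of_ne hi with h | h
      · exact this h hmem hj
      · exact this h hj hmem
    have key := node_mem_relSpan X x (fun i => (c i).graft s₀) j
      (ih j (ht.1 _ ⟨j, rfl⟩) hj)
    rw [← Finsupp.mapDomain_comp] at key
    convert key using 2
    funext s
    simp only [Function.comp_apply, DecTree.graft, DecTree.bind]
    congr 1
    funext i
    by_cases h : i = j
    · subst h; simp
    · rw [Function.update_of_ne h]
      refine bind_congr _ fun o ho => ?_
      cases o with
      | none => exact absurd ho (hd i h)
      | some o => rfl

/-- The linear map on components of free operads induced by a map of trees. -/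
def mapObj {X : SModule.{u, v} k} {I J : Type} (φ : LinTree X I → LinTree X J)
    (h : ∀ r ∈ linRel X I, r.mapDomain φ ∈ linRel X J) : Obj X I →ₗ[k] Obj X J :=
  (linRel X I).mapQ (linRel X J) (Finsupp.lmapDomain k k φ) h

/-- The class of a tree. -/
def cls {X : SModule.{u, v} k} {I : Type} (t : LinTree X I) : Obj X I :=
  (linRel X I).mkQ (.single t 1)

theorem hom_ext {X : SModule.{u, v} k} {I : Type} {M : Type*} [AddCommGroup M] [Module k M]
    {f g : Obj X I →ₗ[k] M} (h : ∀ t, f (cls t) = g (cls t)) : f = g :=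
  Submodule.linearMap_qext _ (Finsupp.lhom_ext' fun t => LinearMap.ext_ring (h t))

/-- Relabelling of the leaves. -/
def map {X : SModule.{u, v} k} {I J : Type} (e : I ≃ J) : Obj X I →ₗ[k] Obj X J :=
  mapObj (fun t => ⟨t.1.relabel e, t.2.relabel e⟩) fun r hr => by
    have := bind_mem_relSpan X (fun i => leaf (e i)) hr
    simp only [linRel, Submodule.mem_comap, Finsupp.lmapDomain_apply,
      ← Finsupp.mapDomain_comp] at this ⊢
    exact this

/-- Grafting of (combinations of) trees onto a fixed tree. -/
def graftOnto {X : SModule.{u, v} k} {I J : Type} (t : LinTree X (Option I)) :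
    Obj X J →ₗ[k] Obj X (I ⊕ J) :=
  mapObj (fun s => ⟨t.1.graft s.1, t.2.graft s.2⟩) fun r hr => by
    have := graft_mem_relSpan X t.1 t.2.1 (t.2.2 none) hr
    simp only [linRel, Submodule.mem_comap, Finsupp.lmapDomain_apply,
      ← Finsupp.mapDomain_comp] at this ⊢
    exact this

/-- The bilinear extension of the grafting of trees. -/
def comp {X : SModule.{u, v} k} {I J : Type} :
    Obj X (Option I) →ₗ[k] Obj X J →ₗ[k] Obj X (I ⊕ J) :=
  (linRel X (Option I)).liftQ (Finsupp.linearCombination k graftOnto) fun r hr => by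
    refine LinearMap.mem_ker.2 (hom_ext fun s => ?_)
    have key := bind_mem_relSpan X
      (fun o : Option I => o.elim (s.1.relabel Sum.inr) fun i => leaf (Sum.inl i)) hr
    have h : Finsupp.linearCombination k graftOnto r (cls s) = (linRel X (I ⊕ J)).mkQ
        (r.mapDomain fun t => ⟨t.1.graft s.1, t.2.graft s.2⟩) := by
      clear key hr
      induction r using Finsupp.induction_linear with
      | zero => simp
      | add f g hf hg => simp [Finsupp.mapDomain_add, hf, hg]
      | single t a =>
        rw [Finsupp.linearCombination_single, Finsupp.mapDomain_single, LinearMap.smul_apply,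
          ← mul_one a, ← smul_eq_mul, ← Finsupp.smul_single, map_smul, smul_eq_mul, mul_one]
        congr 1
        change (linRel X (I ⊕ J)).mkQ (Finsupp.mapDomain _ (Finsupp.single s 1)) = _
        rw [Finsupp.mapDomain_single]
    rw [h, LinearMap.zero_apply, Submodule.mkQ_apply, Submodule.Quotient.mk_eq_zero]
    simp only [linRel, Submodule.mem_comap, Finsupp.lmapDomain_apply,
      ← Finsupp.mapDomain_comp] at key ⊢
    exact key

theorem map_cls {X : SModule.{u, v} k} {I J : Type} (e : I ≃ J) (t : LinTree X I) :
    map e (cls t) = cls ⟨t.1.relabel e, t.2.relabel e⟩ := by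
  change (linRel X J).mkQ (Finsupp.mapDomain _ (Finsupp.single t 1)) = _
  rw [Finsupp.mapDomain_single]; rfl

theorem comp_cls {X : SModule.{u, v} k} {I J : Type} (t : LinTree X (Option I))
    (s : LinTree X J) : comp (cls t) (cls s) = cls ⟨t.1.graft s.1, t.2.graft s.2⟩ := by
  change Finsupp.linearCombination k graftOnto (Finsupp.single t 1) (cls s) = _
  rw [Finsupp.linearCombination_single, one_smul]
  change (linRel X (I ⊕ J)).mkQ (Finsupp.mapDomain _ (Finsupp.single s 1)) = _
  rw [Finsupp.mapDomain_single]; rfl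

theorem induction_cls {X : SModule.{u, v} k} {I : Type} {C : Obj X I → Prop} (p : Obj X I)
    (cls : ∀ t, C (cls t)) (add : ∀ p q, C p → C q → C (p + q))
    (smul : ∀ (a : k) p, C p → C (a • p)) (zero : C 0) : C p := by
  obtain ⟨p, rfl⟩ := Submodule.Quotient.mk_surjective _ p
  induction p using Finsupp.induction_linear with
  | zero => exact zero
  | add f g hf hg => exact add _ _ hf hg
  | single t a =>
    have := smul a _ (cls t)
    rwa [FreeOperad.cls, ← map_smul, Finsupp.smul_single, smul_eq_mul, mul_one] at this

/-- The unit: the tree without vertices. -/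
def one (X : SModule.{u, v} k) : Obj X Unit := cls ⟨leaf (), by simp [IsLinear, leaves]⟩

/-- Two trees that agree have the same class. -/
theorem cls_congr {X : SModule.{u, v} k} {I : Type} {t s : LinTree X I} (h : t.1 = s.1) :
    cls t = cls s := congrArg cls (Subtype.ext h)

end FreeOperad

open FreeOperad in
/-- The free operad `T(X)` on an `S`-module `X`: its elements are the linear combinations of
trees with vertices labelled by `X`. -/
def freeOperad {k : Type u} [Field k] (X : SModule.{u, v} k) : Operad.{u, max u v} k where
  obj I _ := Obj X I
  map e := FreeOperad.map e
  one := FreeOperad.one X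
  comp := FreeOperad.comp
  map_refl p := by
    induction p using induction_cls with
    | zero => simp
    | add _ _ h h' => simp [h, h']
    | smul _ _ h => simp [h]
    | cls t =>
      rw [map_cls]
      exact cls_congr (DecTree.bind_leaf _)
  map_trans e e' p := by
    induction p using induction_cls with
    | zero => simp
    | add _ _ h h' => simp [h, h']
    | smul _ _ h => simp [h]
    | cls t =>
      simp only [map_cls]
      exact cls_congr (by simp [DecTree.relabel, DecTree.bind_bind, DecTree.bind])
  comp_map e e' p q := by
    induction p using induction_cls with
    | zero => simp
    | add _ _ h h' => simp [h, h']
    | smul _ _ h => simp [h]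
    | cls t =>
      induction q using induction_cls with
      | zero => simp
      | add _ _ h h' => simp [h, h']
      | smul _ _ h => simp [h]
      | cls s =>
        simp only [map_cls, comp_cls]
        refine cls_congr ?_
        simp only [DecTree.graft, DecTree.relabel, DecTree.bind_bind]
        congr 1
        funext o
        cases o <;> simp [DecTree.bind, DecTree.bind_bind]
  one_comp q := by
    induction q using induction_cls with
    | zero => simp
    | add _ _ h h' => simp [h, h']
    | smul _ _ h => simp [h]
    | cls s =>
      simp only [FreeOperad.one, map_cls, comp_cls]
      exact cls_congr rfl
  comp_one p := by
    induction p using induction_cls with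
    | zero => simp
    | add _ _ h h' => simp [h, h']
    | smul _ _ h => simp [h]
    | cls t =>
      simp only [FreeOperad.one, map_cls, comp_cls]
      refine cls_congr ?_
      simp only [DecTree.graft, DecTree.relabel]
      congr 1
      funext o
      cases o <;> rfl
  comp_seq p q r := by
    induction p using induction_cls with
    | zero => simp
    | add _ _ h h' => simp [h, h']
    | smul _ _ h => simp [h]
    | cls t =>
      induction q using induction_cls with
      | zero => simp
      | add _ _ h h' => simp [h, h']
      | smul _ _ h => simp [h]
      | cls s =>
        induction r using induction_cls with
        | zero => simp
        | add _ _ h h' => simp [h, h']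
        | smul _ _ h => simp [h]
        | cls z =>
          simp only [map_cls, comp_cls]
          refine cls_congr ?_
          simp only [DecTree.graft, DecTree.relabel, DecTree.bind_bind]
          congr 1
          funext o
          rcases o with _ | i
          · simp only [Option.elim, DecTree.bind_bind]
            congr 1
            funext o
            rcases o with _ | j
            · simp [DecTree.bind, DecTree.bind_bind, sumOptionEquiv]
            · rfl
          · rfl
  comp_par p q r := by
    induction p using induction_cls with
    | zero => simp
    | add _ _ h h' => simp [h, h']
    | smul _ _ h => simp [h]
    | cls t =>
      induction q using induction_cls with
      | zero => simp
      | add _ _ h h' => simp [h, h']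
      | smul _ _ h => simp [h]
      | cls s =>
        induction r using induction_cls with
        | zero => simp
        | add _ _ h h' => simp [h, h']
        | smul _ _ h => simp [h]
        | cls z =>
          simp only [map_cls, comp_cls]
          refine cls_congr ?_
          simp only [DecTree.graft, DecTree.relabel, DecTree.bind_bind]
          congr 1
          funext o
          rcases o with _ | _ | i
          · simp [DecTree.bind, DecTree.bind_bind, optionSumEquiv, optionSwapEquiv, sumRightCommEquiv]
          · simp [DecTree.bind, DecTree.bind_bind, optionSumEquiv, optionSwapEquiv, sumRightCommEquiv]
          · rfl

namespace FreeOperad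

variable {k : Type u} [Field k]

theorem mapLabel_mem_relSpan {X : SModule.{u, v} k} {Z : SModule.{u, w} k}
    (φ : ∀ n, X.obj n →ₗ[k] Z.obj n)
    (hφ : ∀ n σ x, φ n (X.ρ n σ x) = Z.ρ n σ (φ n x)) {I : Type}
    {r : DecTree X.obj I →₀ k} (hr : r ∈ relSpan X I) :
    r.mapDomain (DecTree.mapLabel fun n => φ n) ∈ relSpan Z I := by
  have : relSpan X I ≤ (relSpan Z I).comap
      (Finsupp.lmapDomain k k (DecTree.mapLabel fun n => φ n)) := by
    refine Submodule.span_le.2 fun r (hr : Rel X r) => ?_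
    change Finsupp.lmapDomain k k (DecTree.mapLabel fun n => φ n) r ∈ relSpan Z I
    induction hr with
    | add x y c =>
      simp only [map_sub, Finsupp.lmapDomain_apply, Finsupp.mapDomain_single, DecTree.mapLabel,
        map_add]
      exact Submodule.subset_span (Rel.add _ _ _)
    | smul a x c =>
      simp only [map_sub, Finsupp.lmapDomain_apply, Finsupp.mapDomain_single, DecTree.mapLabel,
        map_smul]
      exact Submodule.subset_span (Rel.smul a _ _)
    | perm σ x c =>
      simp only [map_sub, Finsupp.lmapDomain_apply, Finsupp.mapDomain_single, DecTree.mapLabel,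
        hφ]
      exact Submodule.subset_span (Rel.perm σ _ fun j => (c j).mapLabel fun n => φ n)
    | congr x c j _ ih =>
      have := node_mem_relSpan Z (φ _ x) (fun i => (c i).mapLabel fun n => φ n) j ih
      simp only [Finsupp.lmapDomain_apply, ← Finsupp.mapDomain_comp] at this ⊢
      convert this using 2
      funext t
      simp only [Function.comp_apply, DecTree.mapLabel]
      congr 1
      funext i
      by_cases h : i = j
      · subst h; simp
      · simp [h]
  exact this hr

/-- The map `T(X) → T(Z)` induced by a morphism of `S`-modules `φ : X → Z`. -/
def mapGen {X : SModule.{u, v} k} {Z : SModule.{u, w} k}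
    (φ : ∀ n, X.obj n →ₗ[k] Z.obj n)
    (hφ : ∀ n σ x, φ n (X.ρ n σ x) = Z.ρ n σ (φ n x)) (I : Type) [Finite I] :
    (freeOperad X).obj I →ₗ[k] (freeOperad Z).obj I :=
  (linRel X I).mapQ (linRel Z I)
    (Finsupp.lmapDomain k k fun t : LinTree X I =>
      (⟨t.1.mapLabel fun n => φ n, t.2.mapLabel _⟩ : LinTree Z I)) fun r hr => by
    have := mapLabel_mem_relSpan φ hφ hr
    simp only [linRel, Submodule.mem_comap, Finsupp.lmapDomain_apply,
      ← Finsupp.mapDomain_comp] at this ⊢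
    exact this

end FreeOperad

section Products

variable {k : Type u} [Field k] (X : SModule.{u, v} k) (Y : SModule.{u, w} k)

/-- The inclusion `T(X) → T(X ⊕ Y)`. -/
def freeInl (I : Type) [Finite I] :
    (freeOperad X).obj I →ₗ[k] (freeOperad (X.sum Y)).obj I :=
  FreeOperad.mapGen (fun n => LinearMap.inl k (X.obj n) (Y.obj n))
    (fun n σ x => (congrArg (Prod.mk (X.ρ n σ x)) (map_zero (Y.ρ n σ))).symm) I

/-- The inclusion `T(Y) → T(X ⊕ Y)`. -/
def freeInr (I : Type) [Finite I] :
    (freeOperad Y).obj I →ₗ[k] (freeOperad (X.sum Y)).obj I :=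
  FreeOperad.mapGen (fun n => LinearMap.inr k (X.obj n) (Y.obj n))
    (fun n σ y => (congrArg (fun z => (z, Y.ρ n σ y)) (map_zero (X.ρ n σ))).symm) I

variable (R : ∀ n : ℕ, Set ((freeOperad X).obj (Fin n)))
  (S : ∀ n : ℕ, Set ((freeOperad Y).obj (Fin n)))

/-- The coproduct `P ∨ Q = T(X ⊕ Y) / (R ∪ S)` of the operads `P = T(X) / (R)` and
`Q = T(Y) / (S)`. -/
def coprodOperad : Operad.{u, max u v w} k :=
  (freeOperad (X.sum Y)).quotient fun n =>
    freeInl X Y (Fin n) '' R n ∪ freeInr X Y (Fin n) '' S n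

/-- The tree `α(β₁, …, βₘ)`, with `α ∈ Y(m)`, `βⱼ ∈ X(aⱼ)` and its leaves labelled by
means of the bijection `e`. -/
def twoLevelTree {m n : ℕ} (α : Y.obj m) (a : Fin m → ℕ) (β : ∀ j, X.obj (a j))
    (e : (Σ j, Fin (a j)) ≃ Fin n) : DecTree (X.sum Y).obj (Fin n) :=
  .node ((0, α) : X.obj m × Y.obj m) fun j =>
    .node ((β j, 0) : X.obj (a j) × Y.obj (a j)) fun l => .leaf (e ⟨j, l⟩)

theorem twoLevelTree_isLinear {m n : ℕ} (α : Y.obj m) (a : Fin m → ℕ) (β : ∀ j, X.obj (a j))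
    (e : (Σ j, Fin (a j)) ≃ Fin n) : (twoLevelTree X Y α a β e).IsLinear := by
  refine ⟨DecTree.nodup_leaves_node _ _ (fun j => DecTree.nodup_leaves_node _ _ ?_ ?_) ?_,
    fun i => ?_⟩
  · intro l; simp [DecTree.leaves]
  · intro l l' i hi hi'
    simp only [DecTree.mem_leaves_leaf] at hi hi'
    simpa using e.injective (hi.symm.trans hi')
  · intro j j' i hi hi'
    obtain ⟨l, hl⟩ := (DecTree.mem_leaves_node _ _ _).1 hi
    obtain ⟨l', hl'⟩ := (DecTree.mem_leaves_node _ _ _).1 hi'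
    have := ((DecTree.mem_leaves_leaf _ _).1 hl).symm.trans ((DecTree.mem_leaves_leaf _ _).1 hl')
    exact congrArg Sigma.fst (e.injective this)
  · exact (DecTree.mem_leaves_node _ _ _).2 ⟨(e.symm i).1, (DecTree.mem_leaves_node _ _ _).2
      ⟨(e.symm i).2, (DecTree.mem_leaves_leaf _ _).2 (by simp)⟩⟩

/-- The component of arity `n` of the composite `S`-module `Y ∘ X`, as the subspace of
`T(X ⊕ Y)` spanned by the elements `α(β₁, …, βₘ)` with `α` in `Y` and all `βⱼ` in `X`. -/
def compositeYX (n : ℕ) : Submodule k ((freeOperad (X.sum Y)).obj (Fin n)) :=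
  Submodule.span k {t | ∃ (m : ℕ) (α : Y.obj m) (a : Fin m → ℕ) (β : ∀ j, X.obj (a j))
    (e : (Σ j, Fin (a j)) ≃ Fin n),
    t = FreeOperad.cls ⟨twoLevelTree X Y α a β e, twoLevelTree_isLinear X Y α a β e⟩}

/-- The corolla of a generator. -/
def corolla (Z : SModule.{u, w} k) {n : ℕ} (z : Z.obj n) : (freeOperad Z).obj (Fin n) :=
  FreeOperad.cls ⟨.node z .leaf, by
    refine ⟨DecTree.nodup_leaves_node _ _ (fun j => ?_) fun j l i hi hi' => ?_, fun i => ?_⟩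
    · simp [DecTree.leaves]
    · simp only [DecTree.mem_leaves_leaf] at hi hi'
      exact hi.symm.trans hi'
    · simp [DecTree.mem_leaves_node, DecTree.mem_leaves_leaf]⟩

/-- The canonical map `T(X ⊕ Y) → P ∨ Q`. -/
def toCoprod {I : Type} [Finite I] :
    (freeOperad (X.sum Y)).obj I →ₗ[k] (coprodOperad X Y R S).obj I :=
  Operad.quotientMk _ _

/-- The images in `P ∨ Q` of the generators of `P`. -/
def leftGenerators (n : ℕ) : Set ((coprodOperad X Y R S).obj (Fin n)) :=
  {p | ∃ x : X.obj n, p = toCoprod X Y R S (freeInl X Y (Fin n) (corolla X x))}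

/-- The almost composite product
`P ▽₀ Q = P ∨ Q / (α(β₁, …, βₘ) : α ∈ Y, βⱼ ∈ X)`. -/
def almostCompositeProduct : Operad.{u, max u v w} k :=
  (coprodOperad X Y R S).quotient fun n =>
    {p | ∃ t : compositeYX X Y n, p = toCoprod X Y R S (t : (freeOperad (X.sum Y)).obj (Fin n))}

/-- The operad
`P ∨ Q / (α(β₁, …, βₘ) - f(α(β₁, …, βₘ)) : α ∈ Y, βⱼ ∈ X)`. -/
def rewritingQuotient
    (f : ∀ n : ℕ, compositeYX X Y n →ₗ[k] (coprodOperad X Y R S).obj (Fin n)) :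
    Operad.{u, max u v w} k :=
  (coprodOperad X Y R S).quotient fun n =>
    {p | ∃ t : compositeYX X Y n,
      p = toCoprod X Y R S (t : (freeOperad (X.sum Y)).obj (Fin n)) - f n t}

end Products

end

/-! The coproduct `P ∨ Q` is graded so that the relations of `P` and `Q` are homogeneous while `f`
strictly raises the degree. Give each input of a tree a positive weight. A vertex labelled by `Y`
contributes 0; a vertex labelled by `X` contributes `growth` of its total leaf weight minus the sum
of `growth` of the leaf weights of its children. If all labels lie in `X`, the contributions
telescope, so the degree depends only on the input weights: every element of `T(X)`, hence every
relation in `R`, is homogeneous (`freeInl_mem_degPart`), and `T(Y)` sits in degree 0. Degrees add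
under substitution once the input receiving `q` carries the total weight of `q`, so the grading
descends to `P ∨ Q`.

Let `N` be the total weight. Since `growth` is exponential, `α(β₁, …, βₘ)` has degree below `growth
N / 3` (`hasDeg_twoLevelTree`), while the right ideal generated by `X` lives in degrees at least
`growth N / 3` (`mem_of_mem_rightIdeal`). Thus `α(β₁, …, βₘ)` is the lowest-degree term of `α(β₁, …,
βₘ) - f(α(β₁, …, βₘ))`. This passes to the generated ideals (`mem_iSup_leading`): the ideal `J₀` of
the almost composite product consists of sums of lowest-degree terms of elements of the other ideal
`J`. In a fixed arity the degrees are bounded, so complements of these lowest-degree terms span the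
quotient by `J`, and they are a quotient of the quotient by `J₀` (`exists_surjective_of_graded_le`).

Independence of the graded pieces comes from an operator acting on degree `d` by `2 ^ d`; these
scalars are distinct in characteristic zero (`iSupIndep_coprodDeg`). -/

/-! ### Linear algebra: comparing quotients through lowest-degree terms. -/

/-- In each degree, project onto a complement of the lowest-degree terms of `J`. The resulting
endomorphism kills `J₀`, and its range together with `J` is everything, so it induces the
surjection. No finiteness of dimension is needed. -/
theorem exists_surjective_of_graded_le {k : Type*} [Field k] {V : Type*} [AddCommGroup V]
    [Module k V] (E : ℕ → Submodule k V) (hind : iSupIndep E) (htop : ⨆ d, E d = ⊤)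
    (M : ℕ) (hM : ∀ d, M < d → E d = ⊥) (J₀ J : Submodule k V)
    (hJ : J₀ ≤ ⨆ d, E d ⊓ (J ⊔ ⨆ e, ⨆ (_ : d < e), E e)) :
    ∃ g : (V ⧸ J₀) →ₗ[k] (V ⧸ J), Function.Surjective g := by
  classical
  have hint := DirectSum.isInternal_submodule_of_iSupIndep_of_iSup_eq_top hind htop
  -- The prescribed kernel consists of the degree `d` terms of those elements of `J` that have no
  -- component below `d`.
  have hproj : ∀ d, ∃ π : E d →ₗ[k] E d, LinearMap.ker π =
      (J ⊔ ⨆ e, ⨆ (_ : d < e), E e).comap (E d).subtype ∧ ∀ x, π (π x) = π x := by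
    intro d
    obtain ⟨C, hC⟩ := Submodule.exists_isCompl
      ((J ⊔ ⨆ e, ⨆ (_ : d < e), E e).comap (E d).subtype)
    refine ⟨C.subtype ∘ₗ C.projectionOnto _ hC.symm, ?_, fun x => ?_⟩
    · rw [LinearMap.ker_comp_of_ker_eq_bot _ (Submodule.ker_subtype _)]
      simp
    · simp
  choose π hker hπ using hproj
  let e := LinearEquiv.ofBijective (DirectSum.coeLinearMap E) hint
  let Φ : V →ₗ[k] V :=
    (DirectSum.toModule k ℕ V fun d => (E d).subtype ∘ₗ π d) ∘ₗ e.symm.toLinearMap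
  have hΦ : ∀ d (x : E d), Φ x = π d x := by
    intro d x
    have : e.symm (x : V) = DirectSum.lof k ℕ (fun d => E d) d x := by
      rw [LinearEquiv.symm_apply_eq]
      exact (DirectSum.coeLinearMap_lof E d x).symm
    change DirectSum.toModule k ℕ V _ (e.symm (x : V)) = _
    rw [this, DirectSum.toModule_lof]
    rfl
  have hΦ₀ : J₀ ≤ LinearMap.ker (J.mkQ ∘ₗ Φ) := by
    refine hJ.trans (iSup_le fun d x hx => ?_)
    have h0 : π d ⟨x, hx.1⟩ = 0 := by
      rw [← LinearMap.mem_ker, hker]; exact hx.2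
    rw [LinearMap.mem_ker, LinearMap.comp_apply, hΦ d ⟨x, hx.1⟩, h0]
    simp
  refine ⟨J₀.liftQ (J.mkQ ∘ₗ Φ) hΦ₀, ?_⟩
  -- Downward induction on `d`, starting above the bound `M`. Idempotence puts `x - π x` in the
  -- kernel, hence in `J` plus higher degrees, where the induction hypothesis applies.
  have key : ∀ l d, M < d + l → ∀ x ∈ E d, x ∈ LinearMap.range Φ ⊔ J := by
    intro l
    induction l using Nat.strong_induction_on with
    | _ l ih =>
      intro d hd x hx
      by_cases hMd : M < d
      · rw [hM d hMd, Submodule.mem_bot] at hx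
        rw [hx]; exact Submodule.zero_mem _
      have hmem : (⟨x, hx⟩ - π d ⟨x, hx⟩ : E d) ∈ LinearMap.ker (π d) := by
        rw [LinearMap.mem_ker, map_sub, hπ, sub_self]
      rw [hker, Submodule.mem_comap] at hmem
      have hle : (J ⊔ ⨆ e, ⨆ (_ : d < e), E e) ≤ LinearMap.range Φ ⊔ J := by
        refine sup_le le_sup_right (iSup₂_le fun e he y hy => ?_)
        exact ih (l - 1) (by omega) e (by omega) y hy
      have : x = Φ x + (E d).subtype (⟨x, hx⟩ - π d ⟨x, hx⟩) := by
        rw [map_sub, Submodule.subtype_apply, Submodule.subtype_apply, hΦ d ⟨x, hx⟩]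
        abel
      rw [this]
      exact Submodule.add_mem _ (Submodule.mem_sup_left ⟨x, rfl⟩) (hle hmem)
  have hall : LinearMap.range Φ ⊔ J = ⊤ :=
    top_le_iff.1 (htop ▸ iSup_le fun d x hx => key (M + 1) d (by omega) x hx)
  intro y
  obtain ⟨y, rfl⟩ := Submodule.Quotient.mk_surjective _ y
  obtain ⟨_, ⟨x, rfl⟩, j, hj, rfl⟩ := Submodule.mem_sup.1 (hall ▸ Submodule.mem_top : y ∈ _)
  refine ⟨J₀.mkQ x, ?_⟩
  rw [Submodule.mkQ_apply, Submodule.liftQ_apply]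
  simp [(Submodule.Quotient.mk_eq_zero J).2 hj]

noncomputable section

/-! ### Superadditivity of the growth function. -/

/-- A rapidly growing weight. -/
def growth (n : ℕ) : ℕ := 3 ^ n - 3

theorem growth_add_three {n : ℕ} (hn : 1 ≤ n) : growth n + 3 = 3 ^ n := by
  have : 3 ^ 1 ≤ 3 ^ n := Nat.pow_le_pow_right (by norm_num) hn
  unfold growth
  omega

/-- Expanding `(growth a + 3) * (growth b + 3) = 3 ^ (a + b)` gives the two sides up to the
nonnegative term `growth a * growth b`. -/
theorem three_mul_growth_add_le {a b : ℕ} (ha : 1 ≤ a) (hb : 1 ≤ b) :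
    3 * (growth a + growth b) + 6 ≤ growth (a + b) := by
  have h := growth_add_three (n := a + b) (by omega)
  rw [pow_add, ← growth_add_three ha, ← growth_add_three hb] at h
  nlinarith [Nat.zero_le (growth a * growth b)]

theorem growth_add_le (a b : ℕ) : growth a + growth b ≤ growth (a + b) := by
  -- Truncated subtraction makes `growth 0 = 0`.
  rcases Nat.eq_zero_or_pos a with rfl | ha
  · simp [growth]
  rcases Nat.eq_zero_or_pos b with rfl | hb
  · simp [growth]
  have := three_mul_growth_add_le ha hb
  omega

theorem sum_growth_le {ι : Type*} (s : Finset ι) (a : ι → ℕ) :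
    ∑ j ∈ s, growth (a j) ≤ growth (∑ j ∈ s, a j) := by
  classical
  induction s using Finset.induction_on with
  | empty => simp
  | insert j s hj ih =>
    rw [Finset.sum_insert hj, Finset.sum_insert hj]
    exact (Nat.add_le_add_left ih _).trans (growth_add_le _ _)

/-- One part is split off and the others are merged by superadditivity. The factor 3 separates the
degrees of two-level trees from those of the right ideal; the 6 keeps the separation strict after
integer division by 3. -/
theorem three_mul_sum_growth_le {m : ℕ} (hm : 2 ≤ m) (a : Fin m → ℕ) (ha : ∀ j, 1 ≤ a j) :
    3 * ∑ j, growth (a j) + 6 ≤ growth (∑ j, a j) := by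
  obtain ⟨m, rfl⟩ := Nat.exists_eq_add_of_le' hm
  rw [Fin.sum_univ_succ, Fin.sum_univ_succ a]
  have h1 : 1 ≤ ∑ j : Fin (m + 1), a j.succ :=
    (ha _).trans (Finset.single_le_sum (f := fun j : Fin (m + 1) => a j.succ)
      (fun _ _ => Nat.zero_le _) (Finset.mem_univ 0))
  have h2 := sum_growth_le Finset.univ fun j : Fin (m + 1) => a j.succ
  have h3 := three_mul_growth_add_le (ha 0) h1
  omega

/-! ### Sizes and degrees of trees. -/

namespace DecTree

variable {G : ℕ → Type v} {I J : Type}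

/-- The total weight of the leaves. -/
def size (w : I → ℕ) (t : DecTree G I) : ℕ := (t.leaves.map w).sum

theorem size_leaf (w : I → ℕ) (i : I) : (leaf i : DecTree G I).size w = w i := by
  simp [size, leaves]

theorem size_node (w : I → ℕ) {n : ℕ} (x : G n) (c : Fin n → DecTree G I) :
    (node x c).size w = ∑ j, (c j).size w := by
  simp only [size, leaves, List.map_flatten, List.sum_flatten, List.map_ofFn, List.sum_ofFn,
    Function.comp_apply]

theorem size_bind (w : J → ℕ) (f : I → DecTree G J) (t : DecTree G I) :
    (t.bind f).size w = t.size fun i => (f i).size w := by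
  induction t with
  | leaf i => simp [bind, size_leaf]
  | node x c ih => simp [bind, size_node, ih]

theorem IsLinear.sum_map_leaves [Finite I] {M : Type*} [AddCommMonoid M] {t : DecTree G I}
    (ht : t.IsLinear) (w : I → M) : (t.leaves.map w).sum = ∑ᶠ i, w i := by
  classical
  have := Fintype.ofFinite I
  rw [finsum_eq_sum_of_fintype, ← List.sum_toFinset w ht.1]
  congr 1
  ext i
  simp [ht.2 i]

theorem IsLinear.size_eq [Finite I] {t : DecTree G I} (ht : t.IsLinear) (w : I → ℕ) :
    t.size w = ∑ᶠ i, w i := ht.sum_map_leaves w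

end DecTree

open DecTree FreeOperad

variable {k : Type u} [Field k] {X : SModule.{u, v} k} {Y : SModule.{u, w} k}

/-- The inclusion of the first summand of `X ⊕ Y`. -/
def SModule.inl (X : SModule.{u, v} k) (Y : SModule.{u, w} k) (n : ℕ) :
    X.obj n →ₗ[k] (X.sum Y).obj n :=
  LinearMap.inl k (X.obj n) (Y.obj n)

/-- The inclusion of the second summand of `X ⊕ Y`. -/
def SModule.inr (X : SModule.{u, v} k) (Y : SModule.{u, w} k) (n : ℕ) :
    Y.obj n →ₗ[k] (X.sum Y).obj n :=
  LinearMap.inr k (X.obj n) (Y.obj n)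

/-- A tree with vertices of at least two inputs labelled by elements of `X` or of `Y` has
degree `d`: a vertex labelled by `Y` contributes `0`, a vertex labelled by `X` contributes the
`growth` of the weight of its leaves minus the same expressions for its children. -/
inductive HasDeg {I : Type} (w : I → ℕ) : DecTree (X.sum Y).obj I → ℕ → Prop
  | leaf (i : I) : HasDeg w (leaf i) 0
  | inl {n : ℕ} (hn : 2 ≤ n) (x : X.obj n) {c : Fin n → DecTree (X.sum Y).obj I}
      {d : Fin n → ℕ} (hc : ∀ j, HasDeg w (c j) (d j)) (e : ℕ)
      (he : e + ∑ j, growth ((c j).size w) = growth (∑ j, (c j).size w)) :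
      HasDeg w (node (X.inl Y n x) c) (e + ∑ j, d j)
  | inr {n : ℕ} (hn : 2 ≤ n) (y : Y.obj n) {c : Fin n → DecTree (X.sum Y).obj I}
      {d : Fin n → ℕ} (hc : ∀ j, HasDeg w (c j) (d j)) :
      HasDeg w (node (X.inr Y n y) c) (∑ j, d j)

namespace HasDeg

variable {I J : Type}

/-- At an `X`-vertex the bound telescopes; at a `Y`-vertex it follows from superadditivity. -/
theorem deg_le {w : I → ℕ} {t : DecTree (X.sum Y).obj I} {d : ℕ} (h : HasDeg w t d) :
    d ≤ growth (t.size w) := by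
  induction h with
  | leaf i => exact Nat.zero_le _
  | inl hn x hc e he ih =>
    rw [size_node, ← he]
    exact Nat.add_le_add_left (Finset.sum_le_sum fun j _ => ih j) e
  | inr hn y hc ih =>
    rw [size_node]
    exact (Finset.sum_le_sum fun j _ => ih j).trans (sum_growth_le _ _)

theorem leaves_ne_nil {w : I → ℕ} {t : DecTree (X.sum Y).obj I} {d : ℕ} (h : HasDeg w t d) :
    t.leaves ≠ [] := by
  induction h with
  | leaf i => simp [leaves]
  | inl hn x hc e he ih =>
    obtain ⟨i, hi⟩ := List.exists_mem_of_ne_nil _ (ih ⟨0, by omega⟩)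
    exact List.ne_nil_of_mem ((mem_leaves_node _ _ i).2 ⟨_, hi⟩)
  | inr hn y hc ih =>
    obtain ⟨i, hi⟩ := List.exists_mem_of_ne_nil _ (ih ⟨0, by omega⟩)
    exact List.ne_nil_of_mem ((mem_leaves_node _ _ i).2 ⟨_, hi⟩)

/-- Weighting each input by the size of the tree substituted there leaves the contribution of every
old vertex unchanged, so each leaf just adds the degree of its tree. -/
theorem bind {w : J → ℕ} {v : I → ℕ} {f : I → DecTree (X.sum Y).obj J} {a : I → ℕ}
    (hv : ∀ i, v i = (f i).size w) (hf : ∀ i, HasDeg w (f i) (a i))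
    {t : DecTree (X.sum Y).obj I} {d : ℕ} (h : HasDeg v t d) :
    HasDeg w (t.bind f) (d + (t.leaves.map a).sum) := by
  obtain rfl : v = fun i => (f i).size w := funext hv
  induction h with
  | leaf i => simpa [leaves, DecTree.bind] using hf i
  | @inl n hn x c d hc e he ih =>
    have h := HasDeg.inl (Y := Y) hn x ih e (by simpa only [size_bind] using he)
    rw [Finset.sum_add_distrib, ← add_assoc] at h
    simpa only [DecTree.bind, leaves, List.map_flatten, List.sum_flatten, List.map_ofFn,
      List.sum_ofFn, Function.comp_apply] using h
  | @inr n hn y c d hc ih =>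
    have h := HasDeg.inr (X := X) hn y ih
    rw [Finset.sum_add_distrib] at h
    simpa only [DecTree.bind, leaves, List.map_flatten, List.sum_flatten, List.map_ofFn,
      List.sum_ofFn, Function.comp_apply] using h

theorem relabel {w : J → ℕ} (f : I → J) {t : DecTree (X.sum Y).obj I} {d : ℕ}
    (h : HasDeg (w ∘ f) t d) : HasDeg w (t.relabel f) d := by
  have := h.bind (w := w) (f := fun i => DecTree.leaf (f i)) (a := fun _ => 0)
    (fun i => by simp [size_leaf]) (fun i => HasDeg.leaf _)
  simpa [DecTree.relabel] using this

theorem graft [Finite I] [Finite J] {w : I → ℕ} {v : J → ℕ}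
    {t : DecTree (X.sum Y).obj (Option I)} {s : DecTree (X.sum Y).obj J} (ht : t.IsLinear)
    (hs : s.IsLinear) {d e : ℕ} (h : HasDeg (fun o => o.elim (∑ᶠ j, v j) w) t d)
    (h' : HasDeg v s e) : HasDeg (Sum.elim w v) (t.graft s) (d + e) := by
  have key := h.bind (w := Sum.elim w v)
    (f := fun o => o.elim (s.relabel Sum.inr) fun i => DecTree.leaf (Sum.inl i))
    (a := fun o => o.elim e fun _ => 0) ?_ ?_
  -- By linearity `none` labels exactly one leaf; all other leaves receive trees of degree 0.
  · rw [ht.sum_map_leaves, finsum_eq_single _ none] at key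
    · exact key
    · rintro (_ | o) ho
      · exact absurd rfl ho
      · rfl
  · rintro (_ | i)
    · simp [DecTree.relabel, size_bind, size_leaf, hs.size_eq]
    · simp [size_leaf]
  · rintro (_ | i)
    · exact HasDeg.relabel _ (by simpa using h')
    · exact HasDeg.leaf _

end HasDeg

/-! ### The dilation operator that detects the degree. -/

namespace FreeOperad

/-- Children are replaced one at a time by linearity; the finset records those already replaced. -/
theorem single_node_sub_mem_relSpan (Z : SModule.{u, v} k) {I : Type} {n : ℕ} (x : Z.obj n)
    (c c' : Fin n → DecTree Z.obj I) (a : Fin n → k)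
    (h : ∀ j, Finsupp.single (c j) 1 - Finsupp.single (c' j) (a j) ∈ relSpan Z I) :
    Finsupp.single (node x c) 1 - Finsupp.single (node x c') (∏ j, a j) ∈ relSpan Z I := by
  classical
  have key : ∀ s : Finset (Fin n), Finsupp.single (node x c) 1 -
      Finsupp.single (node x (s.piecewise c' c)) (∏ j ∈ s, a j) ∈ relSpan Z I := by
    intro s
    induction s using Finset.induction_on with
    | empty => simp
    | insert j s hj ih =>
      have := node_mem_relSpan Z x (s.piecewise c' c) j (h j)
      rw [← Finsupp.lmapDomain_apply k k, map_sub, Finsupp.lmapDomain_apply,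
        Finsupp.lmapDomain_apply, Finsupp.mapDomain_single, Finsupp.mapDomain_single,
        ← Finset.piecewise_insert, ← Finset.piecewise_eq_of_notMem s c' c hj,
        Function.update_eq_self] at this
      have := add_mem ih (Submodule.smul_mem _ (∏ j ∈ s, a j) this)
      rw [smul_sub, Finsupp.smul_single, Finsupp.smul_single, smul_eq_mul, smul_eq_mul, mul_one,
        sub_add_sub_cancel] at this
      rwa [Finset.prod_insert hj, mul_comm]
  simpa using key Finset.univ

theorem single_node_mem_relSpan_of_child (Z : SModule.{u, v} k) {I : Type} {n : ℕ} (x : Z.obj n)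
    (c : Fin n → DecTree Z.obj I) (j : Fin n) (h : Finsupp.single (c j) 1 ∈ relSpan Z I) :
    Finsupp.single (node x c) (1 : k) ∈ relSpan Z I := by
  have := node_mem_relSpan Z x c j h
  rwa [Finsupp.mapDomain_single, Function.update_eq_self] at this

theorem single_node_zero_mem_relSpan (Z : SModule.{u, v} k) {I : Type} {n : ℕ}
    (c : Fin n → DecTree Z.obj I) : Finsupp.single (node (0 : Z.obj n) c) (1 : k) ∈ relSpan Z I := by
  have := Submodule.subset_span (R := k) (Rel.smul 0 (0 : Z.obj n) c)
  rwa [smul_zero, Finsupp.single_zero, sub_zero] at this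

theorem cls_eq_zero_iff {Z : SModule.{u, v} k} {I : Type} (t : LinTree Z I) :
    cls t = 0 ↔ Finsupp.single t.1 (1 : k) ∈ relSpan Z I := by
  rw [cls, Submodule.mkQ_apply, Submodule.Quotient.mk_eq_zero, linRel, Submodule.mem_comap,
    Finsupp.lmapDomain_apply, Finsupp.mapDomain_single]

end FreeOperad

/-- The dilation of the first summand of `X ⊕ Y`. -/
def SModule.scale (X : SModule.{u, v} k) (Y : SModule.{u, w} k) (a : k) (n : ℕ) :
    (X.sum Y).obj n →ₗ[k] (X.sum Y).obj n :=
  LinearMap.prodMap (a • LinearMap.id : X.obj n →ₗ[k] X.obj n)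
    (LinearMap.id : Y.obj n →ₗ[k] Y.obj n)

theorem SModule.scale_inl (a : k) (n : ℕ) (x : X.obj n) :
    X.scale Y a n (X.inl Y n x) = a • X.inl Y n x :=
  Prod.ext rfl (smul_zero a).symm

theorem SModule.scale_inr (a : k) (n : ℕ) (y : Y.obj n) :
    X.scale Y a n (X.inr Y n y) = X.inr Y n y :=
  Prod.ext (smul_zero a) rfl

theorem SModule.scale_ρ (a : k) (n : ℕ) (σ : Equiv.Perm (Fin n)) (z : (X.sum Y).obj n) :
    X.scale Y a n ((X.sum Y).ρ n σ z) = (X.sum Y).ρ n σ (X.scale Y a n z) :=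
  Prod.ext (map_smul (X.ρ n σ) a z.1).symm rfl

theorem SModule.inl_add_inr (n : ℕ) (z : (X.sum Y).obj n) :
    X.inl Y n z.1 + X.inr Y n z.2 = z :=
  Prod.ext (add_zero z.1) (zero_add z.2)

namespace DecTree

/-- Dilation of the labels of the vertices by powers of `2`, the exponents being the
contributions of the vertices to the degree. -/
def mark {I : Type} (w : I → ℕ) : DecTree (X.sum Y).obj I → DecTree (X.sum Y).obj I
  | leaf i => leaf i
  | node x c => node (X.scale Y
      (2 ^ (growth (∑ j, (c j).size w) - ∑ j, growth ((c j).size w))) _ x) fun j => (c j).mark w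

theorem leaves_mark {I : Type} (w : I → ℕ) (t : DecTree (X.sum Y).obj I) :
    (t.mark w).leaves = t.leaves := by
  induction t with
  | leaf i => rfl
  | node x c ih => simp only [mark, leaves, ih]

end DecTree

/-- An `X`-vertex contributing `e` is dilated by `2 ^ e` and a `Y`-vertex is unchanged;
multilinearity collects the scalars. -/
theorem HasDeg.single_mark_sub_mem {I : Type} {w : I → ℕ} {t : DecTree (X.sum Y).obj I} {d : ℕ}
    (h : HasDeg w t d) :
    Finsupp.single (t.mark w) 1 - Finsupp.single t ((2 : k) ^ d) ∈ relSpan (X.sum Y) I := by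
  induction h with
  | leaf i => simp [mark]
  | @inl n hn x c d hc e he ih =>
    have h1 := single_node_sub_mem_relSpan (X.sum Y) ((2 : k) ^ e • X.inl Y n x) _ c _ ih
    have h2 := Submodule.subset_span (R := k) (Rel.smul (X := X.sum Y) ((2 : k) ^ e) (X.inl Y n x) c)
    have h3 := add_mem h1 (Submodule.smul_mem _ (∏ j, (2 : k) ^ d j) h2)
    rw [smul_sub, Finsupp.smul_single, Finsupp.smul_single, smul_eq_mul, smul_eq_mul, mul_one,
      sub_add_sub_cancel, Finset.prod_pow_eq_pow_sum, mul_comm, ← pow_add] at h3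
    rwa [mark, SModule.scale_inl, ← he, Nat.add_sub_cancel]
  | @inr n hn y c d hc ih =>
    have h1 := single_node_sub_mem_relSpan (X.sum Y) (X.inr Y n y) _ c _ ih
    rw [Finset.prod_pow_eq_pow_sum] at h1
    rwa [mark, SModule.scale_inr]

/-- The two claims are proved together: for a relation below a vertex, the dilation exponent of that
vertex must be the same for all terms, which holds because the terms have a common size. -/
theorem FreeOperad.Rel.mark {I : Type} (w : I → ℕ) {r : DecTree (X.sum Y).obj I →₀ k}
    (h : Rel (X.sum Y) r) :
    (∃ N, r ∈ Finsupp.supported k k {t | t.size w = N}) ∧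
      r.mapDomain (DecTree.mark w) ∈ relSpan (X.sum Y) I := by
  induction h with
  | @add n x y c =>
    refine ⟨⟨∑ j, (c j).size w, sub_mem (sub_mem ?_ ?_) ?_⟩, ?_⟩
    iterate 3 exact Finsupp.single_mem_supported k _ (size_node w _ c)
    simp only [← Finsupp.lmapDomain_apply k k, map_sub]
    simp only [Finsupp.lmapDomain_apply, Finsupp.mapDomain_single, DecTree.mark, map_add]
    exact Submodule.subset_span (Rel.add _ _ _)
  | @smul n a x c =>
    refine ⟨⟨∑ j, (c j).size w, sub_mem ?_ ?_⟩, ?_⟩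
    iterate 2 exact Finsupp.single_mem_supported k _ (size_node w _ c)
    simp only [← Finsupp.lmapDomain_apply k k, map_sub]
    simp only [Finsupp.lmapDomain_apply, Finsupp.mapDomain_single, DecTree.mark, map_smul]
    exact Submodule.subset_span (Rel.smul a _ _)
  | @perm n σ x c =>
    have h1 : ∑ j, ((c ∘ σ) j).size w = ∑ j, (c j).size w :=
      Equiv.sum_comp σ fun j => (c j).size w
    have h2 : ∑ j, growth (((c ∘ σ) j).size w) = ∑ j, growth ((c j).size w) :=
      Equiv.sum_comp σ fun j => growth ((c j).size w)
    refine ⟨⟨∑ j, (c j).size w, sub_mem ?_ ?_⟩, ?_⟩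
    · exact Finsupp.single_mem_supported k _ (size_node w _ c)
    · exact Finsupp.single_mem_supported k _ ((size_node w _ _).trans h1)
    simp only [← Finsupp.lmapDomain_apply k k, map_sub]
    simp only [Finsupp.lmapDomain_apply, Finsupp.mapDomain_single, DecTree.mark, h1, h2,
      SModule.scale_ρ]
    exact Submodule.subset_span (Rel.perm σ _ fun j => (c j).mark w)
  | @congr n x c j r hr ih =>
    obtain ⟨⟨N, hN⟩, ih⟩ := ih
    have hsize : ∀ t ∈ r.support, ∀ i, (Function.update c j t i).size w =
        Function.update (fun i => (c i).size w) j N i := by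
      intro t ht i
      have : t.size w = N := hN ht
      by_cases hi : i = j
      · subst hi; simp [this]
      · simp [hi]
    constructor
    · refine ⟨∑ i, Function.update (fun i => (c i).size w) j N i, ?_⟩
      classical
      intro t ht
      obtain ⟨s, hs, rfl⟩ := Finset.mem_image.1 (Finsupp.mapDomain_support ht)
      exact (size_node w _ _).trans (Finset.sum_congr rfl fun i _ => hsize s hs i)
    · have := node_mem_relSpan (X.sum Y) (X.scale Y (2 ^
        (growth (∑ i, Function.update (fun i => (c i).size w) j N i) -
          ∑ i, growth (Function.update (fun i => (c i).size w) j N i))) n x)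
        (fun i => (c i).mark w) j ih
      rw [← Finsupp.mapDomain_comp] at this ⊢
      convert this using 1
      refine Finsupp.mapDomain_congr fun t ht => ?_
      simp only [Function.comp_apply, DecTree.mark, hsize t ht]
      congr 1
      funext i
      by_cases hi : i = j
      · subst hi; simp
      · simp [hi]


/-! ### The graded pieces of the free operad. -/

namespace FreeOperad

/-- The endomorphism of the components of `T(X ⊕ Y)` induced by `DecTree.mark`. -/
def markObj {I : Type} (w : I → ℕ) : Obj (X.sum Y) I →ₗ[k] Obj (X.sum Y) I :=
  mapObj (fun t => ⟨t.1.mark w, by simpa only [IsLinear, leaves_mark] using t.2⟩) fun r hr => by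
    have h : relSpan (X.sum Y) I ≤ (relSpan (X.sum Y) I).comap
        (Finsupp.lmapDomain k k (DecTree.mark w)) :=
      Submodule.span_le.2 fun r hr => (Rel.mark w hr).2
    have := h hr
    simp only [linRel, Submodule.mem_comap, Finsupp.lmapDomain_apply,
      ← Finsupp.mapDomain_comp] at this ⊢
    exact this

theorem mapObj_cls {Z : SModule.{u, v} k} {I J : Type} (φ : LinTree Z I → LinTree Z J)
    (h : ∀ r ∈ linRel Z I, r.mapDomain φ ∈ linRel Z J) (t : LinTree Z I) :
    mapObj φ h (cls t) = cls (φ t) := by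
  change (linRel Z J).mkQ (Finsupp.mapDomain φ (Finsupp.single t 1)) = _
  rw [Finsupp.mapDomain_single]
  rfl

theorem cls_eq_smul_cls {Z : SModule.{u, v} k} {I : Type} {t s : LinTree Z I} {a : k}
    (h : Finsupp.single t.1 1 - Finsupp.single s.1 a ∈ relSpan Z I) : cls t = a • cls s := by
  rw [← sub_eq_zero, cls, cls, ← map_smul, ← map_sub, Submodule.mkQ_apply,
    Submodule.Quotient.mk_eq_zero, linRel, Submodule.mem_comap, map_sub, map_smul,
    Finsupp.lmapDomain_apply, Finsupp.lmapDomain_apply, Finsupp.mapDomain_single,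
    Finsupp.mapDomain_single, Finsupp.smul_single, smul_eq_mul, mul_one]
  exact h

variable (X Y) in
/-- The span of the classes of the trees of degree `d`. -/
def degPart {I : Type} (w : I → ℕ) (d : ℕ) : Submodule k (Obj (X.sum Y) I) :=
  Submodule.span k {p | ∃ t : LinTree (X.sum Y) I, HasDeg w t.1 d ∧ p = cls t}

theorem cls_mem_degPart {I : Type} {w : I → ℕ} {d : ℕ} {t : LinTree (X.sum Y) I}
    (h : HasDeg w t.1 d) : cls t ∈ degPart X Y w d :=
  Submodule.subset_span ⟨t, h, rfl⟩

theorem markObj_of_mem_degPart {I : Type} {w : I → ℕ} {d : ℕ} {p : Obj (X.sum Y) I}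
    (h : p ∈ degPart X Y w d) : markObj w p = (2 : k) ^ d • p := by
  induction h using Submodule.span_induction with
  | zero => simp
  | add _ _ _ _ h h' => simp [h, h']
  | smul a _ _ h => rw [map_smul, h, smul_comm]
  | mem p h =>
    obtain ⟨t, ht, rfl⟩ := h
    rw [markObj, mapObj_cls]
    exact cls_eq_smul_cls ht.single_mark_sub_mem

theorem degPart_eq_bot {I : Type} [Finite I] {w : I → ℕ} {d : ℕ} (h : growth (∑ᶠ i, w i) < d) :
    degPart X Y w d = ⊥ := by
  refine Submodule.span_eq_bot.2 ?_
  rintro _ ⟨t, ht, rfl⟩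
  have := ht.deg_le
  rw [t.2.size_eq] at this
  omega

theorem degPart_of_isEmpty {I : Type} [IsEmpty I] (w : I → ℕ) (d : ℕ) :
    degPart X Y w d = ⊥ := by
  refine Submodule.span_eq_bot.2 ?_
  rintro _ ⟨t, ht, rfl⟩
  obtain ⟨i, -⟩ := List.exists_mem_of_ne_nil _ ht.leaves_ne_nil
  exact isEmptyElim i

theorem map_mem_degPart {I J : Type} (e : I ≃ J) {w : J → ℕ} {d : ℕ} {p : Obj (X.sum Y) I}
    (h : p ∈ degPart X Y (w ∘ e) d) : FreeOperad.map e p ∈ degPart X Y w d := by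
  refine (Submodule.span_le.2 ?_ :
    degPart X Y (w ∘ e) d ≤ (degPart X Y w d).comap (FreeOperad.map e)) h
  rintro _ ⟨t, ht, rfl⟩
  change FreeOperad.map e (cls t) ∈ degPart X Y w d
  rw [map_cls]
  exact cls_mem_degPart (ht.relabel e)

theorem comp_mem_degPart {I J : Type} [Finite I] [Finite J] {w : I → ℕ} {v : J → ℕ} {d e : ℕ}
    {p : Obj (X.sum Y) (Option I)} {q : Obj (X.sum Y) J}
    (hp : p ∈ degPart X Y (fun o => o.elim (∑ᶠ j, v j) w) d) (hq : q ∈ degPart X Y v e) :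
    FreeOperad.comp p q ∈ degPart X Y (Sum.elim w v) (d + e) := by
  induction hp using Submodule.span_induction with
  | zero => simp
  | add _ _ _ _ h h' => rw [map_add]; exact add_mem h h'
  | smul a _ _ h => rw [map_smul]; exact Submodule.smul_mem _ a h
  | mem p hp =>
    obtain ⟨t, ht, rfl⟩ := hp
    refine (Submodule.span_le.2 ?_ : degPart X Y v e ≤
      (degPart X Y (Sum.elim w v) (d + e)).comap (FreeOperad.comp (cls t))) hq
    rintro _ ⟨s, hs, rfl⟩
    change FreeOperad.comp (cls t) (cls s) ∈ degPart X Y (Sum.elim w v) (d + e)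
    rw [comp_cls]
    exact cls_mem_degPart (ht.graft t.2 s.2 hs)

theorem mapGen_cls {Z : SModule.{u, v} k} {Z' : SModule.{u, w} k}
    (φ : ∀ n, Z.obj n →ₗ[k] Z'.obj n)
    (hφ : ∀ n σ x, φ n (Z.ρ n σ x) = Z'.ρ n σ (φ n x)) {I : Type} [Finite I]
    (t : LinTree Z I) :
    mapGen φ hφ I (cls t) = cls ⟨t.1.mapLabel fun n => φ n, t.2.mapLabel _⟩ := by
  change (linRel Z' I).mkQ (Finsupp.mapDomain (fun t : LinTree Z I =>
    (⟨t.1.mapLabel fun n => φ n, t.2.mapLabel _⟩ : LinTree Z' I)) (Finsupp.single t 1)) = _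
  rw [Finsupp.mapDomain_single]
  rfl

theorem freeInl_cls {I : Type} [Finite I] (t : LinTree X I) :
    freeInl X Y I (cls t) = cls ⟨t.1.mapLabel fun n => X.inl Y n, t.2.mapLabel _⟩ :=
  mapGen_cls _ _ t

theorem freeInr_cls {I : Type} [Finite I] (t : LinTree Y I) :
    freeInr X Y I (cls t) = cls ⟨t.1.mapLabel fun n => X.inr Y n, t.2.mapLabel _⟩ :=
  mapGen_cls _ _ t

/-- The `growth` terms at inner edges cancel, leaving only the root and the leaves. A vertex with at
most one input has label 0, which makes the whole tree vanish. -/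
theorem single_mapLabel_inl (hX : ∀ n ≤ 1, Subsingleton (X.obj n)) {I : Type} (w : I → ℕ)
    (t : DecTree X.obj I) :
    Finsupp.single (t.mapLabel fun n => X.inl Y n) (1 : k) ∈ relSpan (X.sum Y) I ∨
      ∃ d, HasDeg w (t.mapLabel fun n => X.inl Y n) d ∧
        d + (t.leaves.map fun i => growth (w i)).sum = growth (t.size w) := by
  induction t with
  | leaf i => exact .inr ⟨0, HasDeg.leaf i, by simp [leaves, size_leaf]⟩
  | @node n x c ih =>
    by_cases h : ∃ j, Finsupp.single ((c j).mapLabel fun n => X.inl Y n) (1 : k) ∈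
        relSpan (X.sum Y) I
    · obtain ⟨j, hj⟩ := h
      exact .inl (single_node_mem_relSpan_of_child _ _ _ j hj)
    rcases Nat.lt_or_ge 1 n with hn | hn
    · right
      choose d hd hd' using fun j => (ih j).resolve_left fun hj => h ⟨j, hj⟩
      have hs : ∀ j, ((c j).mapLabel fun n => X.inl Y n).size w = (c j).size w := fun j => by
        simp only [size, leaves_mapLabel]
      obtain ⟨e, he⟩ := Nat.exists_eq_add_of_le'
        (sum_growth_le Finset.univ fun j => (c j).size w)
      refine ⟨_, HasDeg.inl hn x hd e (by simp only [hs, he]), ?_⟩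
      rw [size_node, he]
      simp only [leaves, List.map_flatten, List.sum_flatten, List.map_ofFn, List.sum_ofFn,
        Function.comp_apply, ← hd', Finset.sum_add_distrib]
      ring
    · left
      have := hX n hn
      rw [Subsingleton.elim x 0, mapLabel, map_zero]
      exact single_node_zero_mem_relSpan _ _

theorem single_mapLabel_inr (hY : ∀ n ≤ 1, Subsingleton (Y.obj n)) {I : Type} (w : I → ℕ)
    (t : DecTree Y.obj I) :
    Finsupp.single (t.mapLabel fun n => X.inr Y n) (1 : k) ∈ relSpan (X.sum Y) I ∨
      HasDeg w (t.mapLabel fun n => X.inr Y n) 0 := by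
  induction t with
  | leaf i => exact .inr (HasDeg.leaf i)
  | @node n y c ih =>
    by_cases h : ∃ j, Finsupp.single ((c j).mapLabel fun n => X.inr Y n) (1 : k) ∈
        relSpan (X.sum Y) I
    · obtain ⟨j, hj⟩ := h
      exact .inl (single_node_mem_relSpan_of_child _ _ _ j hj)
    rcases Nat.lt_or_ge 1 n with hn | hn
    · right
      have := HasDeg.inr (X := X) hn y fun j => (ih j).resolve_left fun hj => h ⟨j, hj⟩
      rwa [Finset.sum_const_zero] at this
    · left
      have := hY n hn
      rw [Subsingleton.elim y 0, mapLabel, map_zero]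
      exact single_node_zero_mem_relSpan _ _

/-- All trees on `X` with the same input weights have the same degree, so even a relation mixing
different numbers of vertices is homogeneous. -/
theorem freeInl_mem_degPart (hX : ∀ n ≤ 1, Subsingleton (X.obj n)) {I : Type} [Finite I]
    (w : I → ℕ) (p : (freeOperad X).obj I) :
    freeInl X Y I p ∈
      degPart X Y w (growth (∑ᶠ i, w i) - ∑ᶠ i, growth (w i)) := by
  induction p using induction_cls with
  | zero => exact (map_zero (freeInl X Y I)).symm ▸ zero_mem _
  | add _ _ h h' => exact (map_add (freeInl X Y I) _ _).symm ▸ add_mem h h'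
  | smul a _ h => exact (map_smul (freeInl X Y I) a _).symm ▸ Submodule.smul_mem _ a h
  | cls t =>
    refine (congrArg (· ∈ degPart X Y w _) (freeInl_cls t)).mpr ?_
    rcases single_mapLabel_inl (Y := Y) hX w t.1 with h | ⟨d, hd, hd'⟩
    · rw [(cls_eq_zero_iff _).2 h]
      exact zero_mem _
    · rw [t.2.size_eq, t.2.sum_map_leaves] at hd'
      rw [← hd', Nat.add_sub_cancel]
      exact cls_mem_degPart hd

theorem freeInr_mem_degPart (hY : ∀ n ≤ 1, Subsingleton (Y.obj n)) {I : Type} [Finite I]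
    (w : I → ℕ) (p : (freeOperad Y).obj I) : freeInr X Y I p ∈ degPart X Y w 0 := by
  induction p using induction_cls with
  | zero => exact (map_zero (freeInr X Y I)).symm ▸ zero_mem _
  | add _ _ h h' => exact (map_add (freeInr X Y I) _ _).symm ▸ add_mem h h'
  | smul a _ h => exact (map_smul (freeInr X Y I) a _).symm ▸ Submodule.smul_mem _ a h
  | cls t =>
    refine (congrArg (· ∈ degPart X Y w _) (freeInr_cls t)).mpr ?_
    rcases single_mapLabel_inr (X := X) hY w t.1 with h | h
    · rw [(cls_eq_zero_iff _).2 h]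
      exact zero_mem _
    · exact cls_mem_degPart h

/-! ### Trees with a degree span the free operad. -/

variable (X Y) in
/-- The span of the trees that have a degree and the prescribed leaves. -/
def gradedSpan {I : Type} (w : I → ℕ) (l : List I) : Submodule k (DecTree (X.sum Y).obj I →₀ k) :=
  Submodule.span k {r | ∃ s, s.leaves = l ∧ (∃ d, HasDeg w s d) ∧ r = Finsupp.single s 1}

/-- The children are expanded one at a time; the finset holds those still to be expanded. -/
theorem single_node_mem_gradedSpan {I : Type} (w : I → ℕ) {n : ℕ} (z : (X.sum Y).obj n)
    (hz : ∀ c, (∀ j, ∃ d, HasDeg w (c j) d) → ∃ d, HasDeg w (node z c) d)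
    (c : Fin n → DecTree (X.sum Y).obj I)
    (hc : ∀ j, Finsupp.single (c j) (1 : k) ∈
      relSpan (X.sum Y) I ⊔ gradedSpan X Y w (c j).leaves) :
    Finsupp.single (node z c) (1 : k) ∈
      relSpan (X.sum Y) I ⊔ gradedSpan X Y w (node z c).leaves := by
  classical
  have key : ∀ (s : Finset (Fin n)) (c : Fin n → DecTree (X.sum Y).obj I),
      (∀ j ∈ s, Finsupp.single (c j) (1 : k) ∈
        relSpan (X.sum Y) I ⊔ gradedSpan X Y w (c j).leaves) →
      (∀ j ∉ s, ∃ d, HasDeg w (c j) d) →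
      Finsupp.single (node z c) (1 : k) ∈
        relSpan (X.sum Y) I ⊔ gradedSpan X Y w (node z c).leaves := by
    intro s
    induction s using Finset.induction_on with
    | empty =>
      intro c _ h
      exact Submodule.mem_sup_right (Submodule.subset_span
        ⟨_, rfl, hz c fun j => h j (Finset.notMem_empty j), rfl⟩)
    | insert j s hj ih =>
      intro c h h'
      have hle : relSpan (X.sum Y) I ⊔ gradedSpan X Y w (c j).leaves ≤
          (relSpan (X.sum Y) I ⊔ gradedSpan X Y w (node z c).leaves).comap
            (Finsupp.lmapDomain k k fun t => node z (Function.update c j t)) := by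
        refine sup_le (fun r hr => Submodule.mem_sup_left (node_mem_relSpan _ z c j hr))
          (Submodule.span_le.2 ?_)
        rintro _ ⟨t, ht, hd, rfl⟩
        have hl : ∀ i, (Function.update c j t i).leaves = (c i).leaves := by
          intro i
          by_cases hi : i = j
          · subst hi; simp [ht]
          · simp [hi]
        have := ih (Function.update c j t) (fun i hi => by
          rw [Function.update_of_ne (ne_of_mem_of_not_mem hi hj)]
          exact h i (Finset.mem_insert_of_mem hi)) (fun i hi => by
          by_cases hij : i = j
          · subst hij; simpa using hd
          · rw [Function.update_of_ne hij]
            exact h' i (by simp [hij, hi]))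
        simp only [leaves, hl] at this
        rw [SetLike.mem_coe, Submodule.mem_comap, Finsupp.lmapDomain_apply,
          Finsupp.mapDomain_single]
        exact this
      have := hle (h j (Finset.mem_insert_self j s))
      rwa [Submodule.mem_comap, Finsupp.lmapDomain_apply, Finsupp.mapDomain_single, Function.update_eq_self] at this
  exact key Finset.univ c (fun j _ => hc j) fun j hj => absurd (Finset.mem_univ j) hj

/-- Each label splits into its `X`-part and its `Y`-part, and vertices with at most one input
vanish. -/
theorem single_mem_gradedSpan (hX : ∀ n ≤ 1, Subsingleton (X.obj n))
    (hY : ∀ n ≤ 1, Subsingleton (Y.obj n)) {I : Type} (w : I → ℕ)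
    (t : DecTree (X.sum Y).obj I) :
    Finsupp.single t (1 : k) ∈ relSpan (X.sum Y) I ⊔ gradedSpan X Y w t.leaves := by
  induction t with
  | leaf i => exact Submodule.mem_sup_right (Submodule.subset_span ⟨_, rfl, ⟨0, .leaf i⟩, rfl⟩)
  | @node n z c ih =>
    rcases Nat.lt_or_ge 1 n with hn | hn
    · have h1 := single_node_mem_gradedSpan w (X.inl Y n z.1) (fun c hc => by
        choose d hd using hc
        obtain ⟨e, he⟩ := Nat.exists_eq_add_of_le'
          (sum_growth_le Finset.univ fun j => (c j).size w)
        exact ⟨_, HasDeg.inl hn z.1 hd e he.symm⟩) c ih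
      have h2 := single_node_mem_gradedSpan w (X.inr Y n z.2) (fun c hc => by
        choose d hd using hc
        exact ⟨_, HasDeg.inr hn z.2 hd⟩) c ih
      have h3 := Submodule.mem_sup_left (T := gradedSpan X Y w (node z c).leaves)
        (Submodule.subset_span (R := k)
          (Rel.add (X := X.sum Y) (X.inl Y n z.1) (X.inr Y n z.2) c))
      have := add_mem (add_mem h3 h2) h1
      rwa [sub_add_cancel, sub_add_cancel, SModule.inl_add_inr] at this
    · have : z = 0 := Prod.ext ((hX n hn).elim _ _) ((hY n hn).elim _ _)
      rw [this]
      exact Submodule.mem_sup_left (single_node_zero_mem_relSpan _ _)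

theorem iSup_degPart (hX : ∀ n ≤ 1, Subsingleton (X.obj n))
    (hY : ∀ n ≤ 1, Subsingleton (Y.obj n)) {I : Type} (w : I → ℕ) :
    ⨆ d, degPart X Y w d = ⊤ := by
  refine top_le_iff.1 fun p _ => ?_
  induction p using induction_cls with
  | zero => exact zero_mem _
  | add _ _ h h' => exact add_mem (h trivial) (h' trivial)
  | smul a _ h => exact Submodule.smul_mem _ a (h trivial)
  | cls t =>
    obtain ⟨r, hr, q, hq, hrq⟩ := Submodule.mem_sup.1 (single_mem_gradedSpan hX hY w t.1)
    have key : gradedSpan X Y w t.1.leaves ≤ ((⨆ d, degPart X Y w d).comap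
        (linRel (X.sum Y) I).mkQ).map (Finsupp.lmapDomain k k Subtype.val) := by
      refine Submodule.span_le.2 ?_
      rintro _ ⟨s, hs, ⟨d, hd⟩, rfl⟩
      -- Having the same leaves as `t` makes `s` linear, so the expansion stays inside the free
      -- operad.
      have hlin : s.IsLinear := by simpa only [IsLinear, hs] using t.2
      refine ⟨Finsupp.single ⟨s, hlin⟩ 1, ?_, by simp⟩
      exact Submodule.mem_iSup_of_mem d (cls_mem_degPart (t := ⟨s, hlin⟩) hd)
    obtain ⟨q', hq', rfl⟩ := key hq
    have : cls t = (linRel (X.sum Y) I).mkQ q' := by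
      rw [cls, ← sub_eq_zero, ← map_sub, Submodule.mkQ_apply, Submodule.Quotient.mk_eq_zero,
        linRel, Submodule.mem_comap, map_sub, Finsupp.lmapDomain_apply,
        Finsupp.mapDomain_single, ← hrq, add_sub_cancel_right]
      exact hr
    rw [this]
    exact hq'

end FreeOperad

/-! ### Weight gradings of operads and their ideals. -/

theorem LinearMap.apply_apply_mem_iSup {M N L : Type*} [AddCommGroup M] [Module k M]
    [AddCommGroup N] [Module k N] [AddCommGroup L] [Module k L] (f : M →ₗ[k] N →ₗ[k] L)
    {A : ℕ → Submodule k M} {B : ℕ → Submodule k N} {C : ℕ → Submodule k L}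
    (h : ∀ d e, ∀ p ∈ A d, ∀ q ∈ B e, f p q ∈ C (d + e)) {p : M} {q : N}
    (hp : p ∈ ⨆ d, A d) (hq : q ∈ ⨆ e, B e) : f p q ∈ ⨆ d, C d := by
  refine (iSup_le fun d p hp => ?_ : ⨆ d, A d ≤ (⨆ d, C d).comap (f.flip q)) hp
  refine (iSup_le fun e q hq => ?_ : ⨆ e, B e ≤ (⨆ d, C d).comap (f p)) hq
  exact Submodule.mem_iSup_of_mem (d + e) (h d e p hp q hq)

/-- The weights of the inputs of `p` in a composite `p ∘ q`. -/
def optionWeight {I J : Type} (w : I ⊕ J → ℕ) : Option I → ℕ :=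
  fun o => o.elim (∑ᶠ j, w (.inr j)) fun i => w (.inl i)

theorem optionWeight_pos {I J : Type} [Finite J] [Nonempty J] {w : I ⊕ J → ℕ}
    (hw : ∀ i, 0 < w i) (o : Option I) : 0 < optionWeight w o := by
  cases o with
  | none =>
    obtain ⟨j⟩ := ‹Nonempty J›
    exact finsum_pos (fun j => (hw (.inr j)).le) ⟨j, hw (.inr j)⟩ (Set.toFinite _)
  | some i => exact hw _

theorem finsum_optionWeight {I J : Type} [Finite I] [Finite J] (w : I ⊕ J → ℕ) :
    ∑ᶠ o, optionWeight w o = ∑ᶠ i, w i := by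
  have := Fintype.ofFinite I
  have := Fintype.ofFinite J
  simp only [finsum_eq_sum_of_fintype, Fintype.sum_option, Fintype.sum_sum_type, optionWeight,
    Option.elim]
  exact add_comm _ _

/-- A family of subspaces of the components of an operad, indexed by weights of the inputs and by
degrees. -/
abbrev WeightFamily (P : Operad.{u, v} k) :=
  ∀ (I : Type) [Finite I], (I → ℕ) → ℕ → Submodule k (P.obj I)

/-- A family of subspaces compatible with the operations and spanning the operad. -/
structure IsWeightGrading (P : Operad.{u, v} k) (E : WeightFamily P) : Prop where
  iSup_eq_top : ∀ (I : Type) [Finite I] (w : I → ℕ), ⨆ d, E I w d = ⊤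
  subsingleton : ∀ (I : Type) [Finite I], IsEmpty I → Subsingleton (P.obj I)
  map_mem : ∀ {I J : Type} [Finite I] [Finite J] (e : I ≃ J) {w : J → ℕ} {d : ℕ} {p : P.obj I},
    p ∈ E I (w ∘ e) d → P.map e p ∈ E J w d
  comp_mem : ∀ {I J : Type} [Finite I] [Finite J] {w : I ⊕ J → ℕ} {d e : ℕ}
    {p : P.obj (Option I)} {q : P.obj J}, p ∈ E (Option I) (optionWeight w) d →
    q ∈ E J (w ∘ .inr) e → P.comp p q ∈ E (I ⊕ J) w (d + e)

namespace IsWeightGrading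

variable {P : Operad.{u, v} k} {E : WeightFamily P}

/-- The induction needs all positive weights at once, since passing from `p ∘ q` to `p` replaces `w`
by `optionWeight w`. The family `U` is later taken to be the homogeneous part of an ideal, or the
space of lowest-degree terms. -/
theorem mem_iSup_of_inIdeal (hE : IsWeightGrading P E) {G : ∀ n : ℕ, Set (P.obj (Fin n))}
    (U : WeightFamily P)
    (hmap : ∀ {I J : Type} [Finite I] [Finite J] (e : I ≃ J) {w : J → ℕ} {d : ℕ} {p : P.obj I},
      p ∈ U I (w ∘ e) d → P.map e p ∈ U J w d)
    (hleft : ∀ {I J : Type} [Finite I] [Finite J] {w : I ⊕ J → ℕ} {d e : ℕ}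
      {p : P.obj (Option I)} {q : P.obj J}, p ∈ U (Option I) (optionWeight w) d →
      q ∈ E J (w ∘ .inr) e → P.comp p q ∈ U (I ⊕ J) w (d + e))
    (hright : ∀ {I J : Type} [Finite I] [Finite J] {w : I ⊕ J → ℕ} {d e : ℕ}
      {p : P.obj (Option I)} {q : P.obj J}, p ∈ E (Option I) (optionWeight w) d →
      q ∈ U J (w ∘ .inr) e → P.comp p q ∈ U (I ⊕ J) w (d + e))
    (hG : ∀ n, ∀ p ∈ G n, ∀ w : Fin n → ℕ, (∀ i, 0 < w i) → p ∈ ⨆ d, U (Fin n) w d)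
    {I : Type} [Finite I] {p : P.obj I} (hp : P.InIdeal G p) (w : I → ℕ) (hw : ∀ i, 0 < w i) :
    p ∈ ⨆ d, U I w d := by
  induction hp with
  | of h => exact hG _ _ h w hw
  | zero => exact zero_mem _
  | add _ _ h h' => exact add_mem (h w hw) (h' w hw)
  | smul a _ h => exact Submodule.smul_mem _ a (h w hw)
  | @map I J _ _ e p _ h =>
    have : ⨆ d, U I (w ∘ e) d ≤ (⨆ d, U J w d).comap (P.map e) :=
      iSup_le fun d p hp => Submodule.mem_iSup_of_mem d (hmap e hp)
    exact this (h (w ∘ e) fun i => hw (e i))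
  | @comp_left I J _ _ p _ q h =>
    -- For empty `J` the new input would get weight 0, but then `q` is 0.
    rcases isEmpty_or_nonempty J with hJ | hJ
    · have := hE.subsingleton J hJ
      rw [Subsingleton.elim q 0, map_zero]
      exact zero_mem _
    · exact LinearMap.apply_apply_mem_iSup P.comp (fun d e p hp q hq => hleft hp hq)
        (h (optionWeight w) (optionWeight_pos hw))
        (hE.iSup_eq_top J (w ∘ .inr) ▸ Submodule.mem_top)
  | @comp_right I J _ _ p q _ h =>
    exact LinearMap.apply_apply_mem_iSup P.comp (fun d e p hp q hq => hright hp hq)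
      (hE.iSup_eq_top (Option I) (optionWeight w) ▸ Submodule.mem_top)
      (h (w ∘ .inr) fun j => hw (.inr j))

/-- Substituting into an element preserves the total weight and never lowers the degree, so a lower
bound depending only on the total weight persists. -/
theorem mem_iSup_of_inRightIdeal (hE : IsWeightGrading P E) {G : ∀ n : ℕ, Set (P.obj (Fin n))}
    (b : ℕ → ℕ)
    (hG : ∀ n, ∀ p ∈ G n, ∀ w : Fin n → ℕ, (∀ i, 0 < w i) →
      p ∈ ⨆ d, ⨆ (_ : b (∑ᶠ i, w i) ≤ d), E (Fin n) w d)
    {I : Type} [Finite I] {p : P.obj I} (hp : P.InRightIdeal G p) (w : I → ℕ)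
    (hw : ∀ i, 0 < w i) : p ∈ ⨆ d, ⨆ (_ : b (∑ᶠ i, w i) ≤ d), E I w d := by
  induction hp with
  | of h => exact hG _ _ h w hw
  | zero => exact zero_mem _
  | add _ _ h h' => exact add_mem (h w hw) (h' w hw)
  | smul a _ h => exact Submodule.smul_mem _ a (h w hw)
  | @map I J _ _ e p _ h =>
    have hs : ∑ᶠ i, (w ∘ e) i = ∑ᶠ j, w j := finsum_comp_equiv e
    have : ⨆ d, ⨆ (_ : b (∑ᶠ i, (w ∘ e) i) ≤ d), E I (w ∘ e) d ≤
        (⨆ d, ⨆ (_ : b (∑ᶠ i, w i) ≤ d), E J w d).comap (P.map e) :=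
      iSup₂_le fun d hd p hp => Submodule.mem_iSup_of_mem d
        (Submodule.mem_iSup_of_mem (hs ▸ hd) (hE.map_mem e hp))
    exact this (h (w ∘ e) fun i => hw (e i))
  | @comp_left I J _ _ p _ q h =>
    rcases isEmpty_or_nonempty J with hJ | hJ
    · have := hE.subsingleton J hJ
      rw [Subsingleton.elim q 0, map_zero]
      exact zero_mem _
    · refine LinearMap.apply_apply_mem_iSup P.comp (fun d e p hp q hq => ?_)
        (h (optionWeight w) (optionWeight_pos hw))
        (hE.iSup_eq_top J (w ∘ .inr) ▸ Submodule.mem_top)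
      refine (iSup_le fun hd p hp => ?_ : (⨆ (_ : b (∑ᶠ i, optionWeight w i) ≤ d),
        E (Option I) (optionWeight w) d) ≤
        (⨆ (_ : b (∑ᶠ i, w i) ≤ d + e), E (I ⊕ J) w (d + e)).comap (P.comp.flip q)) hp
      rw [finsum_optionWeight] at hd
      exact Submodule.mem_iSup_of_mem (hd.trans (Nat.le_add_right d e)) (hE.comp_mem hp hq)

/-- If each generator of an ideal becomes, modulo the ideal `J`, a sum of elements of higher
degree, then the same is true for all elements of the ideal. -/
theorem mem_iSup_leading (hE : IsWeightGrading P E) {G₀ G : ∀ n : ℕ, Set (P.obj (Fin n))}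
    (hG : ∀ n, ∀ p ∈ G₀ n, ∀ w : Fin n → ℕ, (∀ i, 0 < w i) →
      p ∈ ⨆ d, E (Fin n) w d ⊓ (P.ideal G (Fin n) ⊔ ⨆ e, ⨆ (_ : d < e), E (Fin n) w e))
    {I : Type} [Finite I] {p : P.obj I} (hp : P.InIdeal G₀ p) (w : I → ℕ)
    (hw : ∀ i, 0 < w i) :
    p ∈ ⨆ d, E I w d ⊓ (P.ideal G I ⊔ ⨆ e, ⨆ (_ : d < e), E I w e) := by
  refine hE.mem_iSup_of_inIdeal
    (fun I _ w d => E I w d ⊓ (P.ideal G I ⊔ ⨆ e, ⨆ (_ : d < e), E I w e)) ?_ ?_ ?_ hG hp w hw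
  · rintro I J _ _ e w d p ⟨hp, hp'⟩
    refine ⟨hE.map_mem e hp, ?_⟩
    refine (sup_le (fun p hp => Submodule.mem_sup_left (Operad.InIdeal.map e hp))
      (iSup₂_le fun l hl p hp => ?_) : P.ideal G I ⊔ ⨆ e', ⨆ (_ : d < e'), E I (w ∘ e) e' ≤
        (P.ideal G J ⊔ ⨆ e, ⨆ (_ : d < e), E J w e).comap (P.map e)) hp'
    exact Submodule.mem_sup_right (Submodule.mem_iSup_of_mem l
      (Submodule.mem_iSup_of_mem hl (hE.map_mem e hp)))
  · rintro I J _ _ w d e p q ⟨hp, hp'⟩ hq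
    refine ⟨hE.comp_mem hp hq, ?_⟩
    refine (sup_le (fun p hp => Submodule.mem_sup_left (Operad.InIdeal.comp_left hp q))
      (iSup₂_le fun l hl p hp => ?_) :
        P.ideal G (Option I) ⊔ ⨆ e', ⨆ (_ : d < e'), E (Option I) (optionWeight w) e' ≤
        (P.ideal G (I ⊕ J) ⊔ ⨆ e', ⨆ (_ : d + e < e'), E (I ⊕ J) w e').comap
          (P.comp.flip q)) hp'
    exact Submodule.mem_sup_right (Submodule.mem_iSup_of_mem (l + e)
      (Submodule.mem_iSup_of_mem (Nat.add_lt_add_right hl e) (hE.comp_mem hp hq)))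
  · rintro I J _ _ w d e p q hp ⟨hq, hq'⟩
    refine ⟨hE.comp_mem hp hq, ?_⟩
    refine (sup_le (fun q hq => Submodule.mem_sup_left (Operad.InIdeal.comp_right p hq))
      (iSup₂_le fun l hl q hq => ?_) :
        P.ideal G J ⊔ ⨆ e', ⨆ (_ : e < e'), E J (w ∘ .inr) e' ≤
        (P.ideal G (I ⊕ J) ⊔ ⨆ e', ⨆ (_ : d + e < e'), E (I ⊕ J) w e').comap (P.comp p)) hq'
    exact Submodule.mem_sup_right (Submodule.mem_iSup_of_mem (d + l)
      (Submodule.mem_iSup_of_mem (Nat.add_lt_add_left hl d) (hE.comp_mem hp hq)))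

/-- An ideal with homogeneous generators is spanned by its homogeneous elements. -/
theorem mem_iSup_inf_ideal (hE : IsWeightGrading P E) {G : ∀ n : ℕ, Set (P.obj (Fin n))}
    (hG : ∀ n, ∀ p ∈ G n, ∀ w : Fin n → ℕ, ∃ d, p ∈ E (Fin n) w d)
    {I : Type} [Finite I] {p : P.obj I} (hp : P.InIdeal G p) (w : I → ℕ)
    (hw : ∀ i, 0 < w i) : p ∈ ⨆ d, E I w d ⊓ P.ideal G I := by
  refine hE.mem_iSup_of_inIdeal (fun I _ w d => E I w d ⊓ P.ideal G I) ?_ ?_ ?_ ?_ hp w hw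
  · rintro I J _ _ e w d p ⟨hp, hp'⟩
    exact ⟨hE.map_mem e hp, Operad.InIdeal.map e hp'⟩
  · rintro I J _ _ w d e p q ⟨hp, hp'⟩ hq
    exact ⟨hE.comp_mem hp hq, Operad.InIdeal.comp_left hp' q⟩
  · rintro I J _ _ w d e p q hp ⟨hq, hq'⟩
    exact ⟨hE.comp_mem hp hq, Operad.InIdeal.comp_right p hq'⟩
  · intro n p hp w _
    obtain ⟨d, hd⟩ := hG n p hp w
    exact Submodule.mem_iSup_of_mem d ⟨hd, Operad.InIdeal.of hp⟩

/-- The grading of a quotient. -/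
theorem quotient (hE : IsWeightGrading P E) (G : ∀ n : ℕ, Set (P.obj (Fin n))) :
    IsWeightGrading (P.quotient G) fun I _ w d => (E I w d).map (P.quotientMk G) where
  iSup_eq_top I _ w := by
    rw [← Submodule.map_iSup, hE.iSup_eq_top, Submodule.map_top]
    exact Submodule.range_mkQ _
  subsingleton I _ hI := by
    have := hE.subsingleton I hI
    exact (Submodule.mkQ_surjective (P.ideal G I)).subsingleton
  map_mem := by
    rintro I J _ _ e w d _ ⟨p, hp, rfl⟩
    exact ⟨P.map e p, hE.map_mem e hp, rfl⟩
  comp_mem := by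
    rintro I J _ _ w d e _ _ ⟨p, hp, rfl⟩ ⟨q, hq, rfl⟩
    exact ⟨P.comp p q, hE.comp_mem hp hq, rfl⟩

end IsWeightGrading

/-! ### The gradings of the free operad and of the coproduct. -/

variable (X Y) in
/-- The grading of the free operad `T(X ⊕ Y)`. -/
def freeDeg : WeightFamily (freeOperad (X.sum Y)) := fun _ _ w d => degPart X Y w d

theorem isWeightGrading_freeDeg (hX : ∀ n ≤ 1, Subsingleton (X.obj n))
    (hY : ∀ n ≤ 1, Subsingleton (Y.obj n)) :
    IsWeightGrading (freeOperad (X.sum Y)) (freeDeg X Y) where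
  iSup_eq_top I _ w := iSup_degPart hX hY w
  subsingleton I _ hI := by
    have h : (⊤ : Submodule k (Obj (X.sum Y) I)) = ⊥ := by
      rw [← iSup_degPart hX hY fun _ => 0]
      simp only [degPart_of_isEmpty, iSup_bot]
    exact (Submodule.subsingleton_iff k (M := Obj (X.sum Y) I)).1
      (subsingleton_of_bot_eq_top h.symm)
  map_mem e _ _ _ h := map_mem_degPart e h
  comp_mem {I J} _ _ w _ _ _ _ hp hq := by
    have := comp_mem_degPart (w := w ∘ .inl) (v := w ∘ .inr) hp hq
    rwa [Sum.elim_comp_inl_inr] at this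

/-- Only the `βⱼ` contribute, at most the sum of `growth` over at least two parts of the total
weight. If some vertex has at most one input, the tree vanishes. -/
theorem hasDeg_twoLevelTree (hX : ∀ n ≤ 1, Subsingleton (X.obj n))
    (hY : ∀ n ≤ 1, Subsingleton (Y.obj n)) {m n : ℕ} (α : Y.obj m) (a : Fin m → ℕ)
    (β : ∀ j, X.obj (a j)) (e : (Σ j, Fin (a j)) ≃ Fin n) (w : Fin n → ℕ) (hw : ∀ i, 0 < w i) :
    Finsupp.single (twoLevelTree X Y α a β e) (1 : k) ∈ relSpan (X.sum Y) (Fin n) ∨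
      ∃ d, HasDeg w (twoLevelTree X Y α a β e) d ∧ d < growth (∑ᶠ i, w i) / 3 := by
  rcases Nat.lt_or_ge 1 m with hm | hm
  · by_cases ha : ∃ j, a j ≤ 1
    · obtain ⟨j, hj⟩ := ha
      left
      refine single_node_mem_relSpan_of_child _ _ _ j ?_
      have := hX _ hj
      have hz : ((β j, 0) : X.obj (a j) × Y.obj (a j)) = 0 := by
        rw [Subsingleton.elim (β j) 0]; rfl
      rw [hz]
      exact single_node_zero_mem_relSpan (X.sum Y) _
    · right
      simp only [not_exists, not_le] at ha
      let c : Fin m → DecTree (X.sum Y).obj (Fin n) := fun j =>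
        .node (X.inl Y (a j) (β j)) fun l => .leaf (e ⟨j, l⟩)
      have hsize : ∀ j, 1 ≤ (c j).size w := fun j => by
        rw [size_node]
        refine (size_leaf (G := (X.sum Y).obj) w (e ⟨j, ⟨0, by have := ha j; omega⟩⟩) ▸ hw _ :
          1 ≤ _).trans (Finset.single_le_sum
            (f := fun l => (leaf (e ⟨j, l⟩) : DecTree (X.sum Y).obj (Fin n)).size w)
            (fun _ _ => Nat.zero_le _) (Finset.mem_univ _))
      have hc : ∀ j, ∃ d, HasDeg w (c j) d := fun j => by
        obtain ⟨b, hb⟩ := Nat.exists_eq_add_of_le' (sum_growth_le Finset.univ fun l =>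
          (leaf (e ⟨j, l⟩) : DecTree (X.sum Y).obj (Fin n)).size w)
        exact ⟨_, HasDeg.inl (ha j) (β j) (fun l => HasDeg.leaf (e ⟨j, l⟩)) b hb.symm⟩
      choose d hd using hc
      refine ⟨_, HasDeg.inr hm α hd, ?_⟩
      have h1 := three_mul_sum_growth_le hm _ hsize
      have h2 : ∑ j, (c j).size w = ∑ᶠ i, w i :=
        (size_node w (X.inr Y m α) c).symm.trans
          ((twoLevelTree_isLinear X Y α a β e).size_eq w)
      have h3 : ∑ j, d j ≤ ∑ j, growth ((c j).size w) :=
        Finset.sum_le_sum fun j _ => (hd j).deg_le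
      rw [h2] at h1
      omega
  · left
    have := hY m hm
    have hz : ((0, α) : X.obj m × Y.obj m) = 0 := by
      rw [Subsingleton.elim α 0]; rfl
    rw [twoLevelTree, hz]
    exact single_node_zero_mem_relSpan (X.sum Y) _

variable (R : ∀ n : ℕ, Set ((freeOperad X).obj (Fin n)))
  (S : ∀ n : ℕ, Set ((freeOperad Y).obj (Fin n)))

/-- The grading of the coproduct. -/
def coprodDeg : WeightFamily (coprodOperad X Y R S) := fun I _ w d =>
  (freeDeg X Y I w d).map (toCoprod X Y R S)

theorem isWeightGrading_coprodDeg (hX : ∀ n ≤ 1, Subsingleton (X.obj n))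
    (hY : ∀ n ≤ 1, Subsingleton (Y.obj n)) :
    IsWeightGrading (coprodOperad X Y R S) (coprodDeg R S) :=
  (isWeightGrading_freeDeg hX hY).quotient _

theorem coprodDeg_eq_bot {I : Type} [Finite I] {w : I → ℕ} {d : ℕ}
    (h : growth (∑ᶠ i, w i) < d) : coprodDeg R S I w d = ⊥ := by
  have : freeDeg X Y I w d = ⊥ := degPart_eq_bot h
  rw [coprodDeg, this, Submodule.map_bot]

/-- Characteristic zero enters here: the powers of 2 are distinct eigenvalues. -/
theorem Module.End.iSupIndep_of_le_eigenspace_two_pow [CharZero k] {V : Type*} [AddCommGroup V]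
    [Module k V] (Λ : Module.End k V) (E : ℕ → Submodule k V)
    (h : ∀ d, ∀ p ∈ E d, Λ p = (2 : k) ^ d • p) : iSupIndep E := by
  have hinj : Function.Injective fun d : ℕ => (2 : k) ^ d := by
    intro d e hde
    have : ((2 ^ d : ℕ) : k) = ((2 ^ e : ℕ) : k) := by push_cast; exact hde
    exact Nat.pow_right_injective le_rfl (Nat.cast_injective this)
  exact (Λ.eigenspaces_iSupIndep.comp hinj).mono fun d p hp =>
    Module.End.mem_eigenspace_iff.2 (h d p hp)

/-- The ideal generated by `R` and `S` has homogeneous generators, so `markObj` preserves it and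
descends to the coproduct with eigenvalue `2 ^ d` in degree `d`. -/
theorem iSupIndep_coprodDeg [CharZero k] (hX : ∀ n ≤ 1, Subsingleton (X.obj n))
    (hY : ∀ n ≤ 1, Subsingleton (Y.obj n)) {I : Type} [Finite I] (w : I → ℕ)
    (hw : ∀ i, 0 < w i) : iSupIndep (coprodDeg R S I w) := by
  let K := (freeOperad (X.sum Y)).ideal (fun n =>
    freeInl X Y (Fin n) '' R n ∪ freeInr X Y (Fin n) '' S n) I
  let Λ : (freeOperad (X.sum Y)).obj I →ₗ[k] (freeOperad (X.sum Y)).obj I := markObj w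
  have hΛ : ∀ d, ∀ p ∈ freeDeg X Y I w d, Λ p = (2 : k) ^ d • p :=
    fun d p hp => markObj_of_mem_degPart hp
  have hK : K ≤ K.comap Λ := by
    intro p hp
    have := (isWeightGrading_freeDeg hX hY).mem_iSup_inf_ideal ?_ hp w hw
    · refine (iSup_le fun d p hp => ?_ : (⨆ d, freeDeg X Y I w d ⊓ K) ≤ K.comap Λ) this
      rw [Submodule.mem_comap, hΛ d p hp.1]
      exact Submodule.smul_mem _ _ hp.2
    · rintro n _ (⟨r, -, rfl⟩ | ⟨s, -, rfl⟩) w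
      · exact ⟨_, freeInl_mem_degPart hX w r⟩
      · exact ⟨_, freeInr_mem_degPart hY w s⟩
  refine Module.End.iSupIndep_of_le_eigenspace_two_pow (K.mapQ K Λ hK) _ ?_
  rintro d _ ⟨p, hp, rfl⟩
  have h := congrArg K.mkQ (hΛ d p hp)
  rw [map_smul] at h
  exact h

/-! ### The map `f` raises the degree. -/

/-- A corolla of `X` with at least two inputs has degree `growth` of the total weight minus the sum
of `growth` over the inputs, and that sum is less than a third of the first term. -/
theorem mem_of_mem_rightIdeal (hX : ∀ n ≤ 1, Subsingleton (X.obj n))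
    (hY : ∀ n ≤ 1, Subsingleton (Y.obj n)) {I : Type} [Finite I]
    {p : (coprodOperad X Y R S).obj I}
    (hp : p ∈ (coprodOperad X Y R S).rightIdeal (leftGenerators X Y R S) I) (w : I → ℕ)
    (hw : ∀ i, 0 < w i) :
    p ∈ ⨆ d, ⨆ (_ : growth (∑ᶠ i, w i) / 3 ≤ d), coprodDeg R S I w d := by
  refine (isWeightGrading_coprodDeg R S hX hY).mem_iSup_of_inRightIdeal
    (fun N => growth N / 3) ?_ hp w hw
  rintro n _ ⟨x, rfl⟩ w hw
  rcases Nat.lt_or_ge 1 n with hn | hn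
  · refine Submodule.mem_iSup_of_mem _ (Submodule.mem_iSup_of_mem ?_
      ⟨_, freeInl_mem_degPart hX w (corolla X x), rfl⟩)
    have := three_mul_sum_growth_le hn w hw
    rw [finsum_eq_sum_of_fintype, finsum_eq_sum_of_fintype]
    omega
  · have := hX n hn
    have h0 : corolla X x = 0 := by
      refine (cls_eq_zero_iff _).2 ?_
      rw [Subsingleton.elim x 0]
      exact single_node_zero_mem_relSpan _ _
    rw [h0, map_zero, map_zero]
    exact zero_mem _

/-- Adding and subtracting the value of `f` writes a two-level tree of degree `d` as an element of
the ideal plus terms of degree greater than `d`. -/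
theorem toCoprod_mem_leading (hX : ∀ n ≤ 1, Subsingleton (X.obj n))
    (hY : ∀ n ≤ 1, Subsingleton (Y.obj n))
    (f : ∀ n : ℕ, compositeYX X Y n →ₗ[k] (coprodOperad X Y R S).obj (Fin n))
    (hf : ∀ (n : ℕ) (t : compositeYX X Y n),
      f n t ∈ (coprodOperad X Y R S).rightIdeal (leftGenerators X Y R S) (Fin n))
    (n : ℕ) (t : compositeYX X Y n) (w : Fin n → ℕ) (hw : ∀ i, 0 < w i) :
    toCoprod X Y R S (t : (freeOperad (X.sum Y)).obj (Fin n)) ∈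
      ⨆ d, coprodDeg R S (Fin n) w d ⊓ ((coprodOperad X Y R S).ideal (fun n =>
        {p | ∃ t : compositeYX X Y n,
          p = toCoprod X Y R S (t : (freeOperad (X.sum Y)).obj (Fin n)) - f n t}) (Fin n) ⊔
        ⨆ e, ⨆ (_ : d < e), coprodDeg R S (Fin n) w e) := by
  obtain ⟨t, ht⟩ := t
  refine Submodule.mem_comap.1 ((Submodule.span_le.2 ?_ : compositeYX X Y n ≤ _) ht)
  rintro _ ⟨m, α, a, β, e, rfl⟩
  have hmem : cls ⟨twoLevelTree X Y α a β e, twoLevelTree_isLinear X Y α a β e⟩ ∈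
      compositeYX X Y n := Submodule.subset_span ⟨m, α, a, β, e, rfl⟩
  refine Submodule.mem_comap.2 ?_
  rcases hasDeg_twoLevelTree hX hY α a β e w hw with h | ⟨d, hd, hlt⟩
  · have h0 : toCoprod X Y R S
        (cls ⟨twoLevelTree X Y α a β e, twoLevelTree_isLinear X Y α a β e⟩) = 0 :=
      (congrArg (toCoprod X Y R S) ((cls_eq_zero_iff _).2 h)).trans (map_zero _)
    rw [h0]
    exact zero_mem _
  · refine Submodule.mem_iSup_of_mem d ⟨⟨_, cls_mem_degPart hd, rfl⟩, ?_⟩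
    refine Submodule.mem_sup.2 ⟨_, Operad.InIdeal.of ⟨⟨_, hmem⟩, rfl⟩, f n ⟨_, hmem⟩, ?_,
      sub_add_cancel _ _⟩
    refine (iSup₂_le fun e he => ?_ : (⨆ e, ⨆ (_ : growth (∑ᶠ i, w i) / 3 ≤ e),
      coprodDeg R S (Fin n) w e) ≤ _) (mem_of_mem_rightIdeal R S hX hY (hf n ⟨_, hmem⟩) w hw)
    exact le_iSup₂_of_le e (hlt.trans_le he) le_rfl

end

theorem mainTheorem3 {k : Type u} [Field k] [CharZero k]
    (X : SModule.{u, v} k) (Y : SModule.{u, w} k)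
    (hX : ∀ n ≤ 1, Subsingleton (X.obj n)) (hY : ∀ n ≤ 1, Subsingleton (Y.obj n))
    (R : ∀ n : ℕ, Set ((freeOperad X).obj (Fin n)))
    (S : ∀ n : ℕ, Set ((freeOperad Y).obj (Fin n)))
    (f : ∀ n : ℕ, compositeYX X Y n →ₗ[k] (coprodOperad X Y R S).obj (Fin n))
    (hf : ∀ (n : ℕ) (t : compositeYX X Y n),
      f n t ∈ (coprodOperad X Y R S).rightIdeal (leftGenerators X Y R S) (Fin n))
    (n : ℕ) (hn : 1 ≤ n) :
    ∃ g : (almostCompositeProduct X Y R S).obj (Fin n) →ₗ[k]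
        (rewritingQuotient X Y R S f).obj (Fin n), Function.Surjective g := by
  have hE := isWeightGrading_coprodDeg R S hX hY
  -- Unit weights suffice in the end; general positive weights matter only for the inductions over
  -- composites.
  refine exists_surjective_of_graded_le (coprodDeg R S (Fin n) fun _ => 1)
    (iSupIndep_coprodDeg R S hX hY _ fun _ => one_pos) (hE.iSup_eq_top _ _) _
    (fun d hd => coprodDeg_eq_bot R S hd) _ _ fun p hp => ?_
  refine hE.mem_iSup_leading ?_ hp _ fun _ => one_pos
  rintro n _ ⟨t, rfl⟩ w hw
  exact toCoprod_mem_leading R S hX hY f hf n t w hw
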